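/- A set $A\subseteq\mathbb N$ is a density set if $d(A)=\lim_{n\to\infty}|A\cap\{1,\dots,n\}|/n$ exists, and a null set if $d(A)=0$. Let $\mathcal D$ be the collection of density sets, and for $A,B\in\mathcal D$ write $A\sim B$ if $A\triangle B$ is a null set. Order $\mathcal D/_\sim$ by $[A]\preceq[B]$ iff $A\subseteq B\cup N$ for some null set $N$, and let $\hat d([A])=d(A)$ (well defined). Theorem. Let $\mathcal F\subseteq\mathcal D$ be a family closed under finite intersections, and $\mathcal F/_\sim=\{[A]:A\in\mathcal F\}$. Then there is a $\sigma$-complete Boolean algebra $\Sigma$ order-isomorphically included in $\mathcal D/_\sim$ such that: (a) the least and greatest elements of $\Sigma$ are $[\emptyset]$ and $[\mathbb N]$, and its operations are the natural ones: if $[A],[B]\in\Sigma$ then $A\cap B$, $A\cup B$ and $\mathbb N\setminus A$ are density sets whose classes are the meet, the join and the complement in $\Sigma$; moreover every sequence in $\Sigma$ has a supremum in $\Sigma$, which is also its supremum in $\mathcal D/_\sim$; (b) $\mathcal F/_\sim\subseteq\Sigma$, and $\Sigma$ is $\sigma$-generated by $\mathcal F/_\sim$, i.e. the only subset of $\Sigma$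 that contains $\mathcal F/_\sim$ and the least element and is closed under complements and countable suprema is $\Sigma$ itself; (c) $\hat d$ maps $\Sigma$ into $[0,1]$ and is $\sigma$-additive on $\Sigma$: for every pairwise disjoint sequence $(a_n)$ in $\Sigma$, $\hat d(\bigvee_n a_n)=\sum_n\hat d(a_n)$; (d) if moreover $\mathcal F/_\sim$ is countable and $\Sigma$ has no atoms, then $(\Sigma,\hat d)$ is isomorphic, by an order isomorphism (equivalently, a Boolean isomorphism) that preserves the measure, to the measure algebra of the unit interval, i.e. the measurable subsets of $[0,1]$ modulo Lebesgue null sets with Lebesgue measure. -/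

import Mathlib

open Filter Topology MeasureTheory

noncomputable section

/-! ### Natural density -/

/-- The proportion of `A` inside `{1, …, n}`. -/
def countRatio (A : Set ℕ) (n : ℕ) : ℝ := ((A ∩ Set.Icc 1 n).ncard : ℝ) / (n : ℝ)

/-- `A` has natural density `r`. -/
def HasDensity (A : Set ℕ) (r : ℝ) : Prop := Tendsto (countRatio A) atTop (𝓝 r)

/-- `A` is a density set: its natural density exists. -/
def IsDensitySet (A : Set ℕ) : Prop := ∃ r : ℝ, HasDensity A r

/-- `A` is a null density set. -/
def IsNullSet (A : Set ℕ) : Prop := HasDensity A 0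

/-- The natural density `d(A)` (meaningful for density sets only). -/
def naturalDensity (A : Set ℕ) : ℝ := limUnder atTop (countRatio A)

theorem HasDensity.naturalDensity_eq {A : Set ℕ} {r : ℝ} (h : HasDensity A r) :
    naturalDensity A = r := Tendsto.limUnder_eq h

theorem finite_window (A : Set ℕ) (n : ℕ) : (A ∩ Set.Icc 1 n).Finite :=
  (Set.finite_Icc 1 n).subset Set.inter_subset_right

theorem countRatio_nonneg (A : Set ℕ) (n : ℕ) : 0 ≤ countRatio A n := by
  unfold countRatio; positivity

theorem countRatio_le_add {A B C : Set ℕ} (h : A ⊆ B ∪ C) (n : ℕ) :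
    countRatio A n ≤ countRatio B n + countRatio C n := by
  unfold countRatio
  rw [← add_div]
  gcongr
  have h1 : A ∩ Set.Icc 1 n ⊆ (B ∩ Set.Icc 1 n) ∪ (C ∩ Set.Icc 1 n) := by
    rw [← Set.union_inter_distrib_right]
    exact Set.inter_subset_inter_left _ h
  have h2 := Set.ncard_le_ncard h1 ((finite_window B n).union (finite_window C n))
  exact_mod_cast h2.trans (Set.ncard_union_le _ _)

theorem IsNullSet.of_subset_union {A B C : Set ℕ} (hB : IsNullSet B) (hC : IsNullSet C)
    (h : A ⊆ B ∪ C) : IsNullSet A := by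
  have hs : Tendsto (fun n => countRatio B n + countRatio C n) atTop (𝓝 0) := by
    simpa using Tendsto.add hB hC
  exact squeeze_zero (countRatio_nonneg A) (countRatio_le_add h) hs

theorem isNullSet_empty : IsNullSet ∅ := by
  have : countRatio ∅ = fun _ => 0 := by
    funext n; simp [countRatio]
  simp [IsNullSet, HasDensity, this]

theorem IsNullSet.mono {A B : Set ℕ} (hB : IsNullSet B) (h : A ⊆ B) : IsNullSet A :=
  hB.of_subset_union isNullSet_empty (h.trans Set.subset_union_left)

theorem HasDensity.congr {A B : Set ℕ} {r : ℝ} (hA : HasDensity A r)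
    (h : IsNullSet (symmDiff A B)) : HasDensity B r := by
  have hAB : A ⊆ B ∪ symmDiff A B := fun x hx => by
    by_cases hb : x ∈ B
    · exact Or.inl hb
    · exact Or.inr (Or.inl ⟨hx, hb⟩)
  have hBA : B ⊆ A ∪ symmDiff A B := fun x hx => by
    by_cases ha : x ∈ A
    · exact Or.inl ha
    · exact Or.inr (Or.inr ⟨hx, ha⟩)
  have h1 : Tendsto (fun n => countRatio A n - countRatio (symmDiff A B) n) atTop (𝓝 r) := by
    simpa using Tendsto.sub hA h
  have h2 : Tendsto (fun n => countRatio A n + countRatio (symmDiff A B) n) atTop (𝓝 r) := by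
    simpa using Tendsto.add hA h
  refine tendsto_of_tendsto_of_tendsto_of_le_of_le h1 h2 (fun n => ?_)
    (countRatio_le_add hBA)
  have := countRatio_le_add hAB n
  simp only
  linarith

/-! ### Density sets modulo null density -/

/-- The collection `𝒟` of density sets. -/
abbrev DensitySet : Type := {A : Set ℕ // IsDensitySet A}

/-- `A ∼ B` iff the symmetric difference of `A` and `B` is a null density set. -/
instance densitySetoid : Setoid DensitySet where
  r A B := IsNullSet (symmDiff A.1 B.1)
  iseqv :=
    { refl := fun A => by simpa using isNullSet_empty
      symm := fun {A B} h => by rwa [symmDiff_comm]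
      trans := fun {A B C} h1 h2 => h1.of_subset_union h2 (symmDiff_triangle A.1 B.1 C.1) }

/-- The quotient `𝒟/∼`. -/
def DensityClass : Type := Quotient densitySetoid

namespace DensityClass

/-- The class `[A]` of a density set `A`. -/
def mk (A : DensitySet) : DensityClass := Quotient.mk densitySetoid A

theorem le_congr {A B A' B' : DensitySet} (hA : A ≈ A') (hB : B ≈ B')
    (h : ∃ N : Set ℕ, IsNullSet N ∧ A.1 ⊆ B.1 ∪ N) :
    ∃ N : Set ℕ, IsNullSet N ∧ A'.1 ⊆ B'.1 ∪ N := by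
  obtain ⟨N, hN, hs⟩ := h
  have hA' : IsNullSet (symmDiff A.1 A'.1) := hA
  have hB' : IsNullSet (symmDiff B.1 B'.1) := hB
  refine ⟨(symmDiff A.1 A'.1 ∪ symmDiff B.1 B'.1) ∪ N,
    (hA'.of_subset_union hB' subset_rfl).of_subset_union hN subset_rfl, fun x hx => ?_⟩
  by_cases hxA : x ∈ A.1
  · rcases hs hxA with hxB | hxN
    · by_cases hxB' : x ∈ B'.1
      · exact Or.inl hxB'
      · exact Or.inr (Or.inl (Or.inr (Or.inl ⟨hxB, hxB'⟩)))
    · exact Or.inr (Or.inr hxN)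
  · exact Or.inr (Or.inl (Or.inl (Or.inr ⟨hx, hxA⟩)))

/-- The order of `𝒟/∼`: `[A] ≼ [B]` iff `A ⊆ B ∪ N` for some null density set `N`. -/
instance : PartialOrder DensityClass where
  le := Quotient.lift₂ (fun A B : DensitySet => ∃ N : Set ℕ, IsNullSet N ∧ A.1 ⊆ B.1 ∪ N)
    (fun _ _ _ _ hA hB => propext
      ⟨le_congr hA hB, le_congr (Setoid.symm hA) (Setoid.symm hB)⟩)
  le_refl a := by
    induction a using Quotient.inductionOn with
    | h A => exact ⟨∅, isNullSet_empty, Set.subset_union_left⟩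
  le_trans a b c := by
    induction a using Quotient.inductionOn with
    | h A =>
    induction b using Quotient.inductionOn with
    | h B =>
    induction c using Quotient.inductionOn with
    | h C =>
    rintro ⟨M, hM, hAB⟩ ⟨N, hN, hBC⟩
    refine ⟨M ∪ N, hM.of_subset_union hN subset_rfl, fun x hx => ?_⟩
    rcases hAB hx with h | h
    · rcases hBC h with h | h
      · exact Or.inl h
      · exact Or.inr (Or.inr h)
    · exact Or.inr (Or.inl h)
  le_antisymm a b := by
    induction a using Quotient.inductionOn with
    | h A =>
    induction b using Quotient.inductionOn with
    | h B =>
    rintro ⟨M, hM, hAB⟩ ⟨N, hN, hBA⟩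
    refine Quotient.sound (show IsNullSet (symmDiff A.1 B.1) from
      hM.of_subset_union hN ?_)
    rintro x (⟨hx, hn⟩ | ⟨hx, hn⟩)
    · exact Or.inl ((hAB hx).resolve_left hn)
    · exact Or.inr ((hBA hx).resolve_left hn)

/-- The induced density `d̂([A]) = d(A)`. -/
def density : DensityClass → ℝ :=
  Quotient.lift (fun A : DensitySet => naturalDensity A.1) (fun A B h => by
    obtain ⟨r, hr⟩ := A.2
    rw [hr.naturalDensity_eq, (hr.congr h).naturalDensity_eq])

/-- `A` is a density set and `c` is its class. -/
def IsClassOf (c : DensityClass) (A : Set ℕ) : Prop := ∃ h : IsDensitySet A, c = mk ⟨A, h⟩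

end DensityClass

open DensityClass

/-- The image `ℱ/∼` in `𝒟/∼` of a family `ℱ` of density sets. -/
def classesOf (F : Set (Set ℕ)) : Set DensityClass := {c | ∃ A ∈ F, c.IsClassOf A}

/-! ### σ-algebras inside `𝒟/∼` -/

/-- The order embedding `ι` exhibits the Boolean algebra `S` as a σ-algebra included in `𝒟/∼`:
the Boolean operations of `S` are computed on representatives by the set operations (the
results being density sets again), and every sequence in `S` has a supremum in `S`, which is
also its supremum in `𝒟/∼`. -/
structure IsSigmaAlgebraInclusion {S : Type} [BooleanAlgebra S] (ι : S ↪o DensityClass) :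
    Prop where
  map_bot : (ι ⊥).IsClassOf ∅
  map_top : (ι ⊤).IsClassOf Set.univ
  map_compl : ∀ (a : S) (A : Set ℕ), (ι a).IsClassOf A → (ι aᶜ).IsClassOf Aᶜ
  map_inf : ∀ (a b : S) (A B : Set ℕ), (ι a).IsClassOf A → (ι b).IsClassOf B →
    (ι (a ⊓ b)).IsClassOf (A ∩ B)
  map_sup : ∀ (a b : S) (A B : Set ℕ), (ι a).IsClassOf A → (ι b).IsClassOf B →
    (ι (a ⊔ b)).IsClassOf (A ∪ B)
  exists_isLUB : ∀ a : ℕ → S, ∃ s : S, IsLUB (Set.range a) s ∧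
    IsLUB (Set.range fun n => ι (a n)) (ι s)

/-- The density is σ-additive on `S`: for every pairwise disjoint sequence with supremum `s`,
the density of `s` is the sum of the densities. -/
def IsSigmaAdditive {S : Type} [BooleanAlgebra S] (ι : S ↪o DensityClass) : Prop :=
  ∀ a : ℕ → S, (∀ m n : ℕ, m ≠ n → Disjoint (a m) (a n)) →
    ∀ s : S, IsLUB (Set.range a) s →
      HasSum (fun n => (ι (a n)).density) (ι s).density

/-- `G` σ-generates `S`: the only subset of `S` that contains `G` and `⊥` and is closed under
complements and countable suprema is `S` itself. -/
def SigmaGenerates {S : Type} [BooleanAlgebra S] (G : Set S) : Prop :=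
  ∀ T : Set S, G ⊆ T → ⊥ ∈ T → (∀ a ∈ T, aᶜ ∈ T) →
    (∀ a : ℕ → S, (∀ n, a n ∈ T) → ∀ s : S, IsLUB (Set.range a) s → s ∈ T) →
    T = Set.univ

/-! ### The measure algebra of a measure space -/

/-- Measurable sets up to `μ`-null symmetric difference. -/
def measureAlgebraSetoid {X : Type*} [MeasurableSpace X] (μ : Measure X) :
    Setoid {s : Set X // MeasurableSet s} where
  r s t := s.1 =ᵐ[μ] t.1
  iseqv := ⟨fun _ => ae_eq_refl _, fun h => h.symm, fun h k => h.trans k⟩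

/-- The measure algebra of `μ`: measurable sets modulo `μ`-null sets. -/
def MeasureAlgebra {X : Type*} [MeasurableSpace X] (μ : Measure X) : Type _ :=
  Quotient (measureAlgebraSetoid μ)

namespace MeasureAlgebra

variable {X : Type*} [MeasurableSpace X] {μ : Measure X}

/-- The order of the measure algebra: inclusion up to a null set. -/
instance : PartialOrder (MeasureAlgebra μ) where
  le := Quotient.lift₂ (fun s t : {s : Set X // MeasurableSet s} => s.1 ≤ᵐ[μ] t.1)
    (fun _ _ _ _ hs ht => propext
      ⟨fun h => hs.symm.le.trans (h.trans ht.le), fun h => hs.le.trans (h.trans ht.symm.le)⟩)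
  le_refl a := by
    induction a using Quotient.inductionOn with
    | h s => exact EventuallyLE.refl _ _
  le_trans a b c := by
    induction a using Quotient.inductionOn with
    | h s =>
    induction b using Quotient.inductionOn with
    | h t =>
    induction c using Quotient.inductionOn with
    | h u => exact fun h k => EventuallyLE.trans h k
  le_antisymm a b := by
    induction a using Quotient.inductionOn with
    | h s =>
    induction b using Quotient.inductionOn with
    | h t => exact fun h k => Quotient.sound (EventuallyLE.antisymm h k)

/-- The measure of an element of the measure algebra. -/
def measure : MeasureAlgebra μ → ENNReal :=
  Quotient.lift (fun s : {s : Set X // MeasurableSet s} => μ s.1)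
    (fun _ _ h => measure_congr h)

end MeasureAlgebra

end

/-! ### Probability measures on Boolean algebras and the pseudometric `m (a ∆ b)` -/

section BooleanAlgebraMeasure

open scoped symmDiff

variable {B : Type*} [BooleanAlgebra B]

/-! Density sets are not closed under intersection, but they are closed under complements, disjoint
unions and limits in upper density. Since `F` is closed under intersections, the π-λ argument
(`FiniteDynkin.isBooleanClosed`) builds the Boolean algebra it generates from complements and
disjoint unions alone, so that algebra consists of density sets. Its closure in upper density is
still a Boolean algebra of density sets, and `Σ` is this closure modulo null sets.

Countable suprema come from a diagonal set (`exists_almost_union`). For increasing `A n` and a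
slowly growing `κ`, the set of `x` with `x ∈ A (κ x)` contains each `A n` up to a finite set and
exceeds it by an upper density tending to `0`. It is therefore the supremum among all density
classes, and the density is continuous along the sequence, which gives σ-additivity. For generation,
a σ-closed part of `Σ` is closed for the metric `d (a ∆ b)`, because a fast Cauchy sequence
converges to its limit superior. The classes of the finitely generated algebra are dense in `Σ`.

For (d), countably many generators are coded by one countable chain, through the binary expansion of
itineraries. A chain member `c` is paired with the initial segment `[0, m c]`. These pairs form a
chain in the product algebra, and the two measures agree on the Boolean algebra `P` that they
generate. The closure of `P` is the graph of the isomorphism. It is total on the left because the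
chain generates. It is total on the right because the numbers `m c` are dense in `[0,1]`: a gap
would leave an element that nothing splits, that is, an atom. -/

theorem sup_symmDiff_sup_le (a b c d : B) : (a ⊔ b) ∆ (c ⊔ d) ≤ a ∆ c ⊔ b ∆ d := by
  refine symmDiff_le (sup_le ?_ ?_) (sup_le ?_ ?_)
  · calc a ≤ c ⊔ a ∆ c := by rw [sup_comm]; exact le_symmDiff_sup_right a c
      _ ≤ _ := sup_le_sup le_sup_left le_sup_left
  · calc b ≤ d ⊔ b ∆ d := by rw [sup_comm]; exact le_symmDiff_sup_right b d
      _ ≤ _ := sup_le_sup le_sup_right le_sup_right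
  · calc c ≤ a ⊔ a ∆ c := by rw [sup_comm]; exact le_symmDiff_sup_left a c
      _ ≤ _ := sup_le_sup le_sup_left le_sup_left
  · calc d ≤ b ⊔ b ∆ d := by rw [sup_comm]; exact le_symmDiff_sup_left b d
      _ ≤ _ := sup_le_sup le_sup_right le_sup_right

theorem inf_symmDiff_inf_le (a b c d : B) : (a ⊓ b) ∆ (c ⊓ d) ≤ a ∆ c ⊔ b ∆ d := by
  have h := sup_symmDiff_sup_le aᶜ bᶜ cᶜ dᶜ
  rwa [compl_symmDiff_compl, compl_symmDiff_compl, ← compl_inf, ← compl_inf,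
    compl_symmDiff_compl] at h

theorem sdiff_symmDiff_sdiff_le (a b c d : B) : (a \ b) ∆ (c \ d) ≤ a ∆ c ⊔ b ∆ d := by
  have h := inf_symmDiff_inf_le a bᶜ c dᶜ
  rwa [compl_symmDiff_compl, ← sdiff_eq, ← sdiff_eq] at h

/-- `m` is a probability measure on the Boolean algebra `B`, in which monotone sequences have
suprema along which `m` is continuous. -/
structure IsSigmaMeasure (m : B → ℝ) : Prop where
  nonneg : ∀ a, 0 ≤ m a
  top : m ⊤ = 1
  sup : ∀ a b, Disjoint a b → m (a ⊔ b) = m a + m b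
  exists_isLUB_of_monotone : ∀ a : ℕ → B, Monotone a →
    ∃ s, IsLUB (Set.range a) s ∧ Tendsto (fun n => m (a n)) atTop (𝓝 (m s))

/-- `T` contains `⊥` and is closed under complements and countable suprema. -/
structure IsSigmaClosed (T : Set B) : Prop where
  bot_mem : ⊥ ∈ T
  compl_mem : ∀ a ∈ T, aᶜ ∈ T
  lub_mem : ∀ a : ℕ → B, (∀ n, a n ∈ T) → ∀ s, IsLUB (Set.range a) s → s ∈ T

/-- `T` contains `⊥` and is closed under complements and binary suprema. -/
structure IsBooleanClosed (T : Set B) : Prop where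
  bot_mem : ⊥ ∈ T
  compl_mem : ∀ a ∈ T, aᶜ ∈ T
  sup_mem : ∀ a ∈ T, ∀ b ∈ T, a ⊔ b ∈ T

theorem IsSigmaClosed.isBooleanClosed {T : Set B} (hT : IsSigmaClosed T) : IsBooleanClosed T where
  bot_mem := hT.bot_mem
  compl_mem := hT.compl_mem
  sup_mem a ha b hb := by
    refine hT.lub_mem (fun n => if n = 0 then a else b) (fun n => ?_) _ ⟨?_, fun c hc => ?_⟩
    · by_cases h : n = 0 <;> simp [h, ha, hb]
    · rintro _ ⟨n, rfl⟩
      by_cases h : n = 0 <;> simp [h]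
    · exact sup_le (hc ⟨0, by simp⟩) (hc ⟨1, by simp⟩)

theorem IsBooleanClosed.inf_mem {T : Set B} (hT : IsBooleanClosed T) {a b : B} (ha : a ∈ T)
    (hb : b ∈ T) : a ⊓ b ∈ T := by
  have := hT.compl_mem _ (hT.sup_mem _ (hT.compl_mem a ha) _ (hT.compl_mem b hb))
  simpa using this

theorem IsBooleanClosed.sdiff_mem {T : Set B} (hT : IsBooleanClosed T) {a b : B} (ha : a ∈ T)
    (hb : b ∈ T) : a \ b ∈ T := by
  rw [sdiff_eq]
  exact hT.inf_mem ha (hT.compl_mem b hb)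

theorem IsBooleanClosed.partialSups_mem {T : Set B} (hT : IsBooleanClosed T) {a : ℕ → B}
    (ha : ∀ n, a n ∈ T) (n : ℕ) : partialSups a n ∈ T := by
  induction n with
  | zero => simpa using ha 0
  | succ n ih => rw [partialSups_add_one]; exact hT.sup_mem _ ih _ (ha _)

theorem isLUB_range_partialSups {a : ℕ → B} {s : B} :
    IsLUB (Set.range (partialSups a)) s ↔ IsLUB (Set.range a) s := by
  unfold IsLUB
  rw [upperBounds_range_partialSups]

/-- The elements that `T` approximates arbitrarily well in the pseudometric `m (a ∆ b)`. -/
def approximable (m : B → ℝ) (T : Set B) : Set B := {a | ∀ ε > 0, ∃ b ∈ T, m (a ∆ b) < ε}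

namespace IsSigmaMeasure

variable {m : B → ℝ} (hm : IsSigmaMeasure m)
include hm

theorem bot : m ⊥ = 0 := by
  have := hm.sup ⊥ ⊥ disjoint_bot_left
  rw [sup_bot_eq] at this
  linarith

theorem add_sdiff {a b : B} (h : a ≤ b) : m a + m (b \ a) = m b := by
  rw [← hm.sup _ _ disjoint_sdiff_self_right, sup_sdiff_cancel_right h]

theorem mono {a b : B} (h : a ≤ b) : m a ≤ m b := by
  linarith [hm.add_sdiff h, hm.nonneg (b \ a)]

theorem compl (a : B) : m aᶜ = 1 - m a := by
  have := hm.add_sdiff (le_top (a := a))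
  rw [hm.top, top_sdiff] at this
  linarith

theorem le_one (a : B) : m a ≤ 1 := hm.top ▸ hm.mono le_top

theorem sup_le (a b : B) : m (a ⊔ b) ≤ m a + m b := by
  rw [← sup_sdiff_self_right, hm.sup _ _ disjoint_sdiff_self_right]
  linarith [hm.mono (sdiff_le : b \ a ≤ b)]

theorem le_add {a b c : B} (h : a ≤ b ⊔ c) : m a ≤ m b + m c := (hm.mono h).trans (hm.sup_le b c)

theorem symmDiff_triangle (a b c : B) : m (a ∆ c) ≤ m (a ∆ b) + m (b ∆ c) :=
  hm.le_add (_root_.symmDiff_triangle a b c)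

theorem symmDiff_of_le {a b : B} (h : a ≤ b) : m (a ∆ b) = m b - m a := by
  rw [_root_.symmDiff_of_le h]
  linarith [hm.add_sdiff h]

theorem abs_sub_le (a b : B) : |m a - m b| ≤ m (a ∆ b) := by
  have h1 := hm.le_add (le_symmDiff_sup_right a b)
  have h2 := hm.le_add (le_symmDiff_sup_left a b)
  rw [abs_le]
  constructor <;> linarith

theorem symmDiff_sup_le (a b c d : B) : m ((a ⊔ b) ∆ (c ⊔ d)) ≤ m (a ∆ c) + m (b ∆ d) :=
  hm.le_add (sup_symmDiff_sup_le a b c d)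

theorem symmDiff_sdiff_le (a b c d : B) : m ((a \ b) ∆ (c \ d)) ≤ m (a ∆ c) + m (b ∆ d) :=
  hm.le_add (sdiff_symmDiff_sdiff_le a b c d)

theorem tendsto_of_isLUB {a : ℕ → B} (ha : Monotone a) {s : B} (hs : IsLUB (Set.range a) s) :
    Tendsto (fun n => m (a n)) atTop (𝓝 (m s)) := by
  obtain ⟨t, ht, h⟩ := hm.exists_isLUB_of_monotone a ha
  rwa [hs.unique ht]

theorem exists_isLUB (a : ℕ → B) : ∃ s, IsLUB (Set.range a) s := by
  obtain ⟨s, hs, -⟩ := hm.exists_isLUB_of_monotone _ (partialSups a).monotone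
  exact ⟨s, isLUB_range_partialSups.1 hs⟩

theorem tendsto_partialSups {a : ℕ → B} {s : B} (hs : IsLUB (Set.range a) s) :
    Tendsto (fun n => m (partialSups a n)) atTop (𝓝 (m s)) :=
  hm.tendsto_of_isLUB (partialSups a).monotone (isLUB_range_partialSups.2 hs)

/-- Countable additivity. -/
theorem hasSum_of_isLUB {a : ℕ → B} (ha : ∀ i j, i ≠ j → Disjoint (a i) (a j)) {s : B}
    (hs : IsLUB (Set.range a) s) : HasSum (fun n => m (a n)) (m s) := by
  rw [hasSum_iff_tendsto_nat_of_nonneg (fun i => hm.nonneg _), ← tendsto_add_atTop_iff_nat 1]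
  refine (hm.tendsto_partialSups hs).congr fun n => ?_
  induction n with
  | zero => simp
  | succ n ih =>
    rw [partialSups_add_one, hm.sup, ih, Finset.sum_range_succ _ (n + 1)]
    rw [disjoint_partialSups_left]
    exact fun i hi => ha _ _ (by omega)

/-- Continuity from below puts a countable supremum within any `ε` of one of its partial suprema, so
only finite operations need to be approximated. -/
theorem approximable_isSigmaClosed {T : Set B} (hT : IsBooleanClosed T) :
    IsSigmaClosed (approximable m T) := by
  have hcompl : ∀ a ∈ approximable m T, aᶜ ∈ approximable m T := fun a ha ε hε => by
    obtain ⟨b, hb, h⟩ := ha ε hε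
    exact ⟨bᶜ, hT.compl_mem b hb, by rwa [compl_symmDiff_compl]⟩
  have hbot : ⊥ ∈ approximable m T := fun ε hε => ⟨⊥, hT.bot_mem, by simpa [hm.bot] using hε⟩
  have hsup : ∀ a ∈ approximable m T, ∀ b ∈ approximable m T, a ⊔ b ∈ approximable m T := by
    intro a ha b hb ε hε
    obtain ⟨c, hc, h1⟩ := ha (ε / 2) (by linarith)
    obtain ⟨d, hd, h2⟩ := hb (ε / 2) (by linarith)
    exact ⟨c ⊔ d, hT.sup_mem c hc d hd, by linarith [hm.symmDiff_sup_le a b c d]⟩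
  refine ⟨hbot, hcompl, fun a ha s hs ε hε => ?_⟩
  have hmem := IsBooleanClosed.partialSups_mem ⟨hbot, hcompl, hsup⟩ ha
  obtain ⟨n, hn⟩ := ((hm.tendsto_partialSups hs).eventually
    (lt_mem_nhds (show m s - ε / 2 < m s by linarith))).exists
  obtain ⟨b, hb, h⟩ := hmem n (ε / 2) (by linarith)
  refine ⟨b, hb, ?_⟩
  have h1 := hm.symmDiff_triangle s (partialSups a n) b
  rw [symmDiff_comm s (partialSups a n),
    hm.symmDiff_of_le ((isLUB_range_partialSups.2 hs).1 ⟨n, rfl⟩)] at h1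
  linarith

/-- Each further term enlarges the supremum by at most one step `b (n + k) ∆ b (n + k + 1)`. The
subtracted term is the part of the geometric series not yet spent, which makes the induction close.
-/
theorem le_partialSups_bound {b : ℕ → B} (h : ∀ n, m (b n ∆ b (n + 1)) ≤ 2 * (1 / 2) ^ n)
    (n k : ℕ) : m (partialSups (fun i => b (n + i)) k) ≤
      m (b n) + 4 * (1 / 2) ^ n - 4 * (1 / 2) ^ (n + k) := by
  induction k with
  | zero => simp
  | succ k ih =>
    rw [partialSups_add_one]
    have h1 : partialSups (fun i => b (n + i)) k ⊔ b (n + (k + 1)) ≤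
        partialSups (fun i => b (n + i)) k ⊔ b (n + k) ∆ b (n + k + 1) := by
      refine _root_.sup_le le_sup_left ?_
      refine (le_symmDiff_sup_left (b (n + k)) (b (n + k + 1))).trans ?_
      rw [sup_comm]
      exact sup_le_sup_right (le_partialSups (fun i => b (n + i)) k) _
    have h2 := hm.le_add h1
    have h3 := h (n + k)
    have h4 : ((1 : ℝ) / 2) ^ (n + (k + 1)) = (1 / 2) ^ (n + k) * (1 / 2) := by
      rw [← add_assoc, pow_succ]
    rw [h4]
    linarith

/-- A sequence with summable steps converges to its limit superior. -/
theorem exists_tendsto_symmDiff {T : Set B} (hT : IsSigmaClosed T) {b : ℕ → B}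
    (hb : ∀ n, b n ∈ T) (h : ∀ n, m (b n ∆ b (n + 1)) ≤ 2 * (1 / 2) ^ n) :
    ∃ v ∈ T, Tendsto (fun n => m (b n ∆ v)) atTop (𝓝 0) := by
  choose u hu using fun n => hm.exists_isLUB (fun i => b (n + i))
  have hbu : ∀ n, b n ≤ u n := fun n => (hu n).1 ⟨0, rfl⟩
  have hmu : ∀ n, m (u n) ≤ m (b n) + 4 * (1 / 2) ^ n := fun n =>
    le_of_tendsto (hm.tendsto_partialSups (hu n)) (Eventually.of_forall fun k => by
      have := hm.le_partialSups_bound h n k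
      have h0 : (0 : ℝ) ≤ (1 / 2) ^ (n + k) := by positivity
      linarith)
  -- The limit superior is the infimum of the tail suprema `u n`. Continuity is available for
  -- increasing sequences only, so it is obtained as the complement of a supremum of complements.
  have hanti : Monotone fun n => (u n)ᶜ := monotone_nat_of_le_succ fun n => by
    refine compl_le_compl ((hu (n + 1)).2 ?_)
    rintro _ ⟨i, rfl⟩
    exact (hu n).1 ⟨i + 1, by simp only; congr 1; ring⟩
  obtain ⟨w, hw, hlim⟩ := hm.exists_isLUB_of_monotone _ hanti
  refine ⟨wᶜ, hT.compl_mem _ (hT.lub_mem _ (fun n => hT.compl_mem _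
    (hT.lub_mem _ (fun i => hb (n + i)) _ (hu n))) _ hw), ?_⟩
  have hle : ∀ n, wᶜ ≤ u n := fun n => compl_le_of_compl_le (hw.1 ⟨n, rfl⟩)
  have hgeo : Tendsto (fun n : ℕ => 4 * (1 / 2 : ℝ) ^ n) atTop (𝓝 0) := by
    simpa using (tendsto_pow_atTop_nhds_zero_of_lt_one (r := (1 / 2 : ℝ)) (by norm_num)
      (by norm_num)).const_mul 4
  have hsum : Tendsto (fun n => 4 * (1 / 2 : ℝ) ^ n + (m w - m (u n)ᶜ)) atTop (𝓝 0) := by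
    simpa using hgeo.add (hlim.const_sub (m w))
  refine squeeze_zero (fun n => hm.nonneg _) (fun n => ?_) hsum
  have h1 := hm.symmDiff_triangle (b n) (u n) wᶜ
  rw [hm.symmDiff_of_le (hbu n), symmDiff_comm (u n), hm.symmDiff_of_le (hle n), hm.compl w] at h1
  have h2 := hmu n
  have h3 := hm.compl (u n)
  linarith

/-- A countably closed set is closed for the pseudometric, up to elements at distance zero. -/
theorem exists_mem_symmDiff_eq_zero {T : Set B} (hT : IsSigmaClosed T) {a : B}
    (ha : a ∈ approximable m T) : ∃ v ∈ T, m (a ∆ v) = 0 := by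
  choose b hb h using fun n : ℕ => ha ((1 / 2) ^ n / 2) (by positivity)
  obtain ⟨v, hv, hlim⟩ := hm.exists_tendsto_symmDiff hT hb (fun n => by
    have h1 := hm.symmDiff_triangle (b n) a (b (n + 1))
    rw [symmDiff_comm (b n) a] at h1
    have h2 := h n
    have h3 := h (n + 1)
    rw [pow_succ] at h3
    have : (0 : ℝ) < (1 / 2) ^ n := by positivity
    linarith)
  refine ⟨v, hv, le_antisymm ?_ (hm.nonneg _)⟩
  have hgeo : Tendsto (fun n : ℕ => (1 / 2 : ℝ) ^ n / 2) atTop (𝓝 0) := by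
    simpa using (tendsto_pow_atTop_nhds_zero_of_lt_one (r := (1 / 2 : ℝ)) (by norm_num)
      (by norm_num)).div_const 2
  have hsum : Tendsto (fun n => (1 / 2 : ℝ) ^ n / 2 + m (b n ∆ v)) atTop (𝓝 0) := by
    simpa using hgeo.add hlim
  exact ge_of_tendsto hsum (Eventually.of_forall fun n => by
    linarith [hm.symmDiff_triangle a (b n) v, h n])

end IsSigmaMeasure

/-- The closure of `C` under complements and suprema of disjoint pairs. -/
inductive FiniteDynkin (C : Set B) : B → Prop
  | basic (a : B) : a ∈ C → FiniteDynkin C a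
  | top : FiniteDynkin C ⊤
  | compl (a : B) : FiniteDynkin C a → FiniteDynkin C aᶜ
  | sup (a b : B) : Disjoint a b → FiniteDynkin C a → FiniteDynkin C b → FiniteDynkin C (a ⊔ b)

namespace FiniteDynkin

variable {C : Set B}

theorem inf_of_forall {a : B} (h : ∀ b ∈ C, FiniteDynkin C (a ⊓ b)) (ha : FiniteDynkin C a) {b : B}
    (hb : FiniteDynkin C b) : FiniteDynkin C (a ⊓ b) := by
  induction hb with
  | basic b hb => exact h b hb
  | top => simpa using ha
  | compl b _ ih =>
    -- `a ⊓ bᶜ` is the complement of the disjoint supremum `aᶜ ⊔ (a ⊓ b)`.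
    have := (FiniteDynkin.sup aᶜ (a ⊓ b) (disjoint_compl_left.mono_right inf_le_left)
      ha.compl ih).compl
    convert this using 1
    rw [compl_sup, compl_compl, compl_inf, inf_sup_left, inf_compl_self, bot_sup_eq]
  | sup b c hbc _ _ ihb ihc =>
    rw [inf_sup_left]
    exact .sup _ _ (hbc.mono inf_le_right inf_le_right) ihb ihc

/-- The two rounds of the π-λ argument: one factor is first taken in `C`, and then both are
arbitrary. -/
theorem inf (hC : ∀ a ∈ C, ∀ b ∈ C, a ⊓ b ∈ C) {a b : B} (ha : FiniteDynkin C a)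
    (hb : FiniteDynkin C b) : FiniteDynkin C (a ⊓ b) := by
  refine inf_of_forall (fun c hc => ?_) ha hb
  rw [inf_comm]
  exact inf_of_forall (fun d hd => .basic _ (hC c hc d hd)) (.basic c hc) ha

/-- A family closed under finite infima generates a Boolean algebra by complements and disjoint
suprema. -/
theorem isBooleanClosed (hC : ∀ a ∈ C, ∀ b ∈ C, a ⊓ b ∈ C) :
    IsBooleanClosed {a | FiniteDynkin C a} where
  bot_mem := by
    have := (FiniteDynkin.top (C := C)).compl
    rwa [compl_top] at this
  compl_mem a ha := FiniteDynkin.compl a ha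
  sup_mem a ha b hb := by
    have := (inf hC (FiniteDynkin.compl a ha) (FiniteDynkin.compl b hb)).compl
    rwa [compl_inf, compl_compl, compl_compl] at this

theorem mem_of_isBooleanClosed {T : Set B} (hT : IsBooleanClosed T) (hC : C ⊆ T) {a : B}
    (ha : FiniteDynkin C a) : a ∈ T := by
  induction ha with
  | basic a ha => exact hC ha
  | top => simpa using hT.compl_mem _ hT.bot_mem
  | compl a _ ih => exact hT.compl_mem _ ih
  | sup a b _ _ _ iha ihb => exact hT.sup_mem _ iha _ ihb

end FiniteDynkin

end BooleanAlgebraMeasure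

/-! ### Extending a measure-preserving correspondence to its closure -/

section MeasureIsomorphism

open scoped symmDiff

theorem isSigmaClosed_univ {B : Type*} [BooleanAlgebra B] : IsSigmaClosed (Set.univ : Set B) :=
  ⟨trivial, fun _ _ => trivial, fun _ _ _ _ => trivial⟩

section LimitRelation

variable {B₁ B₂ : Type*} [BooleanAlgebra B₁] [BooleanAlgebra B₂] {m₁ : B₁ → ℝ} {m₂ : B₂ → ℝ}
  {P : Set (B₁ × B₂)}

/-- `(a, u)` is a limit of pairs in `P`. -/
def LimitRelation (m₁ : B₁ → ℝ) (m₂ : B₂ → ℝ) (P : Set (B₁ × B₂)) (a : B₁) (u : B₂) : Prop :=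
  ∀ ε > 0, ∃ p ∈ P, m₁ (a ∆ p.1) < ε ∧ m₂ (u ∆ p.2) < ε

theorem LimitRelation.swap {a : B₁} {u : B₂}
    (h : LimitRelation m₂ m₁ (Prod.swap ⁻¹' P) u a) : LimitRelation m₁ m₂ P a u := fun ε hε => by
  obtain ⟨p, hp, h1, h2⟩ := h ε hε
  exact ⟨p.swap, hp, h2, h1⟩

/-- Pairing in `P` is isometric, so a fast approximation of `a` on the left is a fast Cauchy
sequence on the right, where it converges. -/
theorem exists_limitRelation (h₁ : IsSigmaMeasure m₁) (h₂ : IsSigmaMeasure m₂)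
    (hP : ∀ p ∈ P, ∀ q ∈ P, m₁ (p.1 ∆ q.1) = m₂ (p.2 ∆ q.2)) {a : B₁}
    (ha : ∀ ε > 0, ∃ p ∈ P, m₁ (a ∆ p.1) < ε) : ∃ u, LimitRelation m₁ m₂ P a u := by
  choose p hp h using fun n : ℕ => ha ((1 / 2) ^ n) (by positivity)
  obtain ⟨u, -, hu⟩ := h₂.exists_tendsto_symmDiff isSigmaClosed_univ (b := fun n => (p n).2)
    (fun _ => trivial) (fun n => by
      rw [← hP _ (hp _) _ (hp _)]
      have h3 := h₁.symmDiff_triangle (p n).1 a (p (n + 1)).1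
      rw [symmDiff_comm (p n).1 a] at h3
      have h4 := h n
      have h5 := h (n + 1)
      rw [pow_succ] at h5
      have : (0 : ℝ) < (1 / 2) ^ n := by positivity
      linarith)
  refine ⟨u, fun ε hε => ?_⟩
  have hgeo := tendsto_pow_atTop_nhds_zero_of_lt_one (r := (1 / 2 : ℝ)) (by norm_num) (by norm_num)
  obtain ⟨n, hn1, hn2⟩ :=
    ((hu.eventually (gt_mem_nhds hε)).and (hgeo.eventually (gt_mem_nhds hε))).exists
  exact ⟨p n, hp n, (h n).trans hn2, by rwa [symmDiff_comm]⟩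

/-- Differences are Lipschitz and stay in `P`, so equality of measures passes to the limit. The
value zero encodes the order, and `a' = ⊥` encodes the measure. -/
theorem LimitRelation.measure_sdiff_eq (h₁ : IsSigmaMeasure m₁) (h₂ : IsSigmaMeasure m₂)
    (hP : IsBooleanClosed P) (hPm : ∀ p ∈ P, m₁ p.1 = m₂ p.2) {a a' : B₁} {u u' : B₂}
    (h : LimitRelation m₁ m₂ P a u) (h' : LimitRelation m₁ m₂ P a' u') :
    m₁ (a \ a') = m₂ (u \ u') := by
  refine eq_of_forall_dist_le fun ε hε => ?_
  obtain ⟨p, hp, hp1, hp2⟩ := h (ε / 4) (by linarith)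
  obtain ⟨q, hq, hq1, hq2⟩ := h' (ε / 4) (by linarith)
  have e : m₁ (p.1 \ q.1) = m₂ (p.2 \ q.2) := hPm _ (hP.sdiff_mem hp hq)
  have i1 := (h₁.abs_sub_le (a \ a') (p.1 \ q.1)).trans (h₁.symmDiff_sdiff_le _ _ _ _)
  have i2 := (h₂.abs_sub_le (u \ u') (p.2 \ q.2)).trans (h₂.symmDiff_sdiff_le _ _ _ _)
  rw [Real.dist_eq]
  rw [abs_le] at i1 i2 ⊢
  constructor <;> linarith [i1.1, i1.2, i2.1, i2.2]

end LimitRelation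

/-- A relation that is total on both sides and compatible with the orders is an isomorphism. -/
theorem exists_orderIso_of_relation {α β : Type*} [PartialOrder α] [PartialOrder β]
    (R : α → β → Prop) (hl : ∀ a, ∃ b, R a b) (hr : ∀ b, ∃ a, R a b)
    (hle : ∀ a b a' b', R a b → R a' b' → (a ≤ a' ↔ b ≤ b')) :
    ∃ e : α ≃o β, ∀ a, R a (e a) := by
  choose f hf using hl
  choose g hg using hr
  refine ⟨⟨⟨f, g, fun a => ?_, fun b => ?_⟩, fun {a a'} => (hle _ _ _ _ (hf a) (hf a')).symm⟩, hf⟩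
  · exact le_antisymm ((hle _ _ _ _ (hg _) (hf a)).2 le_rfl) ((hle _ _ _ _ (hf a) (hg _)).2 le_rfl)
  · exact le_antisymm ((hle _ _ _ _ (hf _) (hg b)).1 le_rfl) ((hle _ _ _ _ (hg b) (hf _)).1 le_rfl)

/-! ### Coding a sequence of elements by a single chain -/

section DyadicChain

variable {B : Type*} [BooleanAlgebra B]

/-- `dyadicChain b n j` consists of the points whose itinerary through `b 0, …, b (n - 1)`, read
as a binary number, is less than `j`. -/
def dyadicChain (b : ℕ → B) : ℕ → ℕ → B
  | 0, j => if j = 0 then ⊥ else ⊤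
  -- `b n` is the new lowest bit, `1` inside it and `0` outside. With rounded division, `2 * v + 1 <
  -- j` means `v < j / 2`, and `2 * v < j` means `v < (j + 1) / 2`.
  | n + 1, j => (b n ⊓ dyadicChain b n (j / 2)) ⊔ ((b n)ᶜ ⊓ dyadicChain b n ((j + 1) / 2))

variable (b : ℕ → B)

theorem dyadicChain_zero_right (n : ℕ) : dyadicChain b n 0 = ⊥ := by
  induction n with
  | zero => simp [dyadicChain]
  | succ n ih => simp [dyadicChain, ih]

theorem dyadicChain_monotone (n : ℕ) : Monotone (dyadicChain b n) := by
  induction n with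
  | zero =>
    intro i j hij
    by_cases hi : i = 0
    · simp [dyadicChain, hi]
    · have hj : j ≠ 0 := by omega
      simp [dyadicChain, hj]
  | succ n ih =>
    intro i j hij
    exact sup_le_sup (inf_le_inf_left _ (ih (by omega))) (inf_le_inf_left _ (ih (by omega)))

theorem dyadicChain_succ_two_mul (n j : ℕ) :
    dyadicChain b (n + 1) (2 * j) = dyadicChain b n j := by
  have h1 : 2 * j / 2 = j := by omega
  have h2 : (2 * j + 1) / 2 = j := by omega
  rw [dyadicChain, h1, h2, ← inf_sup_right, sup_compl_eq_top, top_inf_eq]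

theorem dyadicChain_succ_two_mul_add_one (n j : ℕ) : dyadicChain b (n + 1) (2 * j + 1) =
    (b n ⊓ dyadicChain b n j) ⊔ ((b n)ᶜ ⊓ dyadicChain b n (j + 1)) := by
  have h1 : (2 * j + 1) / 2 = j := by omega
  have h2 : (2 * j + 1 + 1) / 2 = j + 1 := by omega
  rw [dyadicChain, h1, h2]

theorem dyadicChain_two_pow (n : ℕ) : dyadicChain b n (2 ^ n) = ⊤ := by
  induction n with
  | zero => simp [dyadicChain]
  | succ n ih => rw [pow_succ', dyadicChain_succ_two_mul, ih]

theorem dyadicChain_add (n k j : ℕ) :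
    dyadicChain b (n + k) (2 ^ k * j) = dyadicChain b n j := by
  induction k with
  | zero => simp
  | succ k ih => rw [← add_assoc, pow_succ', mul_assoc, dyadicChain_succ_two_mul, ih]

/-- Both elements reappear at the common level `n + k`, where the chain is monotone in its
threshold. -/
theorem dyadicChain_total (n i k j : ℕ) : dyadicChain b n i ≤ dyadicChain b k j ∨
    dyadicChain b k j ≤ dyadicChain b n i := by
  rw [← dyadicChain_add b n k i, ← dyadicChain_add b k n j, add_comm k n]
  exact (le_total _ _).imp (fun h => dyadicChain_monotone b _ h)
    (fun h => dyadicChain_monotone b _ h)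

/-- At level `n + 1`, the increment from `2 * N` to `2 * N + 1` is the part of the `N`-th cell of
level `n` outside `b n`. Joining these over all cells gives `(b n)ᶜ`. -/
theorem mem_of_dyadicChain_mem {T : Set B} (hT : IsBooleanClosed T)
    (h : ∀ n j, dyadicChain b n j ∈ T) (n : ℕ) : b n ∈ T := by
  have key : ∀ N, (b n)ᶜ ⊓ dyadicChain b n N ∈ T := fun N => by
    induction N with
    | zero => simpa [dyadicChain_zero_right] using hT.bot_mem
    | succ N ih =>
      have hd := hT.sdiff_mem (h (n + 1) (2 * N + 1)) (h (n + 1) (2 * N))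
      have := hT.sup_mem _ ih _ hd
      convert this using 1
      rw [dyadicChain_succ_two_mul, dyadicChain_succ_two_mul_add_one, sup_sdiff,
        inf_sdiff_assoc, inf_sdiff_assoc, sdiff_self, inf_bot_eq, bot_sup_eq, ← inf_sup_left,
        sup_sdiff_cancel_right (dyadicChain_monotone b n N.le_succ)]
  have := hT.compl_mem _ (key (2 ^ n))
  simpa [dyadicChain_two_pow] using this

end DyadicChain

/-! ### Atomlessness and density of the measures of a chain -/

section Atomless

variable {B : Type*} [BooleanAlgebra B] {m : B → ℝ}

/-- The partial suprema of a chain are themselves members of it. -/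
theorem IsSigmaMeasure.measure_isLUB_le_of_chain (hm : IsSigmaMeasure m) {k : ℕ → B}
    (hk : ∀ i j, k i ≤ k j ∨ k j ≤ k i) {p : ℝ} (hp : ∀ i, m (k i) ≤ p) {s : B}
    (hs : IsLUB (Set.range k) s) : m s ≤ p := by
  have hmem : ∀ n, ∃ i, partialSups k n = k i := fun n => by
    induction n with
    | zero => exact ⟨0, by simp⟩
    | succ n ih =>
      obtain ⟨i, hi⟩ := ih
      rw [partialSups_add_one, hi]
      rcases hk i (n + 1) with h | h
      · exact ⟨n + 1, sup_eq_right.2 h⟩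
      · exact ⟨i, sup_eq_left.2 h⟩
  refine le_of_tendsto (hm.tendsto_partialSups hs) (Eventually.of_forall fun n => ?_)
  obtain ⟨i, hi⟩ := hmem n
  rw [hi]
  exact hp i

/-- In an atomless algebra the measures of the members of a generating chain are dense in the
unit interval. -/
theorem IsSigmaMeasure.exists_chain_measure_between (hm : IsSigmaMeasure m)
    (hatom : ∀ a : B, ¬ IsAtom a) {k : ℕ → B} (hk : ∀ i j, k i ≤ k j ∨ k j ≤ k i)
    (hbot : ∃ i, k i = ⊥) (htop : ∃ i, k i = ⊤)
    (hgen : ∀ T : Set B, IsSigmaClosed T → (∀ i, k i ∈ T) → T = Set.univ)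
    {p q : ℝ} (hp : 0 ≤ p) (hpq : p < q) (hq : q ≤ 1) : ∃ i, p < m (k i) ∧ m (k i) < q := by
  by_contra! hgap
  obtain ⟨i₀, hi₀⟩ := hbot
  obtain ⟨i₁, hi₁⟩ := htop
  have hk₁ : ∀ i, m (k i) ≤ p ∨ q ≤ m (k i) := fun i => by
    by_cases h : m (k i) ≤ p
    · exact Or.inl h
    · exact Or.inr (hgap i (not_le.1 h))
  -- The chain is cut at the gap. Indices on the wrong side are sent to `⊥`, written as `k i₀` or
  -- `(k i₁)ᶜ` so that both sequences remain chains.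
  let low : ℕ → B := fun i => if m (k i) ≤ p then k i else k i₀
  let high : ℕ → B := fun i => if m (k i) ≤ p then (k i₁)ᶜ else (k i)ᶜ
  obtain ⟨s, hs⟩ := hm.exists_isLUB low
  obtain ⟨t, ht⟩ := hm.exists_isLUB high
  have hms : m s ≤ p := by
    refine hm.measure_isLUB_le_of_chain (fun i j => ?_) (fun i => ?_) hs
    · dsimp only [low]
      split_ifs <;> exact hk _ _
    · dsimp only [low]
      split_ifs with h
      · exact h
      · rwa [hi₀, hm.bot]
  have hmt : m t ≤ 1 - q := by
    refine hm.measure_isLUB_le_of_chain (fun i j => ?_) (fun i => ?_) ht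
    · dsimp only [high]
      split_ifs <;> simp only [compl_le_compl_iff_le] <;> exact hk _ _
    · dsimp only [high]
      split_ifs with h
      · rw [hi₁, compl_top, hm.bot]; linarith
      · rw [hm.compl]
        linarith [(hk₁ i).resolve_left h]
  have hne : tᶜ \ s ≠ ⊥ := fun h0 => by
    have h1 := hm.mono (sdiff_eq_bot_iff.1 h0)
    rw [hm.compl] at h1
    linarith
  -- The elements that do not split `tᶜ \ s` form a σ-closed set containing the chain. Hence nothing
  -- splits it, and it is an atom.
  have hall : {a : B | tᶜ \ s ≤ a ∨ tᶜ \ s ≤ aᶜ} = Set.univ := by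
    refine hgen _ ⟨Or.inr (by simp), fun a ha => ?_, fun a ha u hu => ?_⟩ fun i => ?_
    · simpa [or_comm] using ha
    · by_cases h : ∃ n, tᶜ \ s ≤ a n
      · obtain ⟨n, hn⟩ := h
        exact Or.inl (hn.trans (hu.1 ⟨n, rfl⟩))
      · push Not at h
        refine Or.inr (le_compl_comm.1 (hu.2 ?_))
        rintro _ ⟨n, rfl⟩
        exact le_compl_comm.1 ((ha n).resolve_left (h n))
    · by_cases h : m (k i) ≤ p
      · right
        have h1 : k i ≤ s := hs.1 ⟨i, by simp [low, h]⟩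
        rw [sdiff_eq]
        exact inf_le_right.trans (compl_le_compl h1)
      · left
        have h1 : (k i)ᶜ ≤ t := ht.1 ⟨i, by simp [high, h]⟩
        exact sdiff_le.trans (compl_le_of_compl_le h1)
  refine hatom (tᶜ \ s) ⟨hne, fun a ha => ?_⟩
  rcases (hall ▸ Set.mem_univ a : a ∈ {a : B | tᶜ \ s ≤ a ∨ tᶜ \ s ≤ aᶜ}) with h | h
  · exact absurd h (not_le_of_gt ha)
  · exact le_compl_self.1 (ha.le.trans h)

end Atomless

/-! ### Measurable sets as an algebra, before null sets are identified -/

section Probability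

variable {X : Type*} [MeasurableSpace X] (μ : Measure X) [IsProbabilityMeasure μ]

theorem isSigmaMeasure_measureReal :
    IsSigmaMeasure fun s : {s : Set X // MeasurableSet s} => μ.real s.1 where
  nonneg _ := measureReal_nonneg
  top := by simp
  sup a b hab := by
    refine measureReal_union ?_ b.2
    rw [Set.disjoint_iff_inter_eq_empty]
    exact congrArg Subtype.val (disjoint_iff.1 hab)
  exists_isLUB_of_monotone a ha := by
    refine ⟨⟨⋃ n, (a n).1, .iUnion fun n => (a n).2⟩, ⟨?_, fun c hc => ?_⟩, ?_⟩
    · rintro _ ⟨n, rfl⟩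
      exact Set.subset_iUnion (fun n => (a n).1) n
    · exact Set.iUnion_subset fun n => hc ⟨n, rfl⟩
    · exact (ENNReal.tendsto_toReal (measure_ne_top _ _)).comp
        (tendsto_measure_iUnion_atTop fun i j hij => ha hij)

theorem IsSigmaClosed.mem_of_generateFrom {T : Set {s : Set X // MeasurableSet s}}
    (hT : IsSigmaClosed T) {C : Set (Set X)}
    (hX : ‹MeasurableSpace X› = MeasurableSpace.generateFrom C)
    (hC : ∀ s (hs : MeasurableSet s), s ∈ C → ⟨s, hs⟩ ∈ T)
    (s : {s : Set X // MeasurableSet s}) : s ∈ T := by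
  obtain ⟨s, hs⟩ := s
  subst hX
  induction s, hs using MeasurableSpace.generateFrom_induction with
  | hC t ht h => exact hC t h ht
  | empty => exact hT.bot_mem
  | compl t ht h => exact hT.compl_mem _ h
  | iUnion f hf h =>
    refine hT.lub_mem _ h _ ⟨?_, fun c hc => ?_⟩
    · rintro _ ⟨n, rfl⟩
      exact Set.subset_iUnion f n
    · exact Set.iUnion_subset fun n => hc ⟨n, rfl⟩

end Probability

/-! ### Isomorphism with the measure algebra of the unit interval -/

section UnitInterval

variable {B : Type*} [BooleanAlgebra B] {m : B → ℝ}

theorem approximable_Iic_of_dense {P : Set {s : Set unitInterval // MeasurableSet s}}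
    (hbot : ⟨Set.Iic 0, measurableSet_Iic⟩ ∈ P)
    (h : ∀ p q : ℝ, 0 ≤ p → p < q → q ≤ 1 → ∃ x : unitInterval, p < x ∧ (x : ℝ) < q ∧
      ⟨Set.Iic x, measurableSet_Iic⟩ ∈ P) (x : unitInterval) :
    ⟨Set.Iic x, measurableSet_Iic⟩ ∈ approximable
      (fun s : {s : Set unitInterval // MeasurableSet s} => volume.real s.1) P := by
  intro ε hε
  obtain ⟨y, hyP, hyx, hy⟩ : ∃ y : unitInterval, (⟨Set.Iic y, measurableSet_Iic⟩ ∈ P) ∧ y ≤ x ∧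
      (x : ℝ) - y < ε := by
    -- For `x < ε` the interval `(x - ε, x)` leaves `[0,1]`, and the endpoint `0` is close enough.
    by_cases hx : (x : ℝ) < ε
    · exact ⟨0, hbot, unitInterval.nonneg', by simpa using hx⟩
    · obtain ⟨y, hy1, hy2, hyP⟩ := h (x - ε) x (by linarith) (by linarith) x.2.2
      exact ⟨y, hyP, Subtype.coe_le_coe.1 hy2.le, by linarith⟩
  refine ⟨_, hyP, ?_⟩
  have hle : (⟨Set.Iic y, measurableSet_Iic⟩ : {s : Set unitInterval // MeasurableSet s}) ≤
      ⟨Set.Iic x, measurableSet_Iic⟩ := Set.Iic_subset_Iic.2 hyx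
  rw [symmDiff_comm]
  refine ((isSigmaMeasure_measureReal volume).symmDiff_of_le hle).trans_lt ?_
  simpa [measureReal_def, x.2.1, y.2.1] using hy

theorem LimitRelation.measureAlgebra_le_iff (hm : IsSigmaMeasure m) (hpos : ∀ a, m a = 0 → a = ⊥)
    {P : Set (B × {s : Set unitInterval // MeasurableSet s})} (hP : IsBooleanClosed P)
    (hPm : ∀ p ∈ P, m p.1 = volume.real p.2.1) {a a' : B}
    {u u' : {s : Set unitInterval // MeasurableSet s}}
    (h : LimitRelation m (fun s => volume.real s.1) P a u)
    (h' : LimitRelation m (fun s => volume.real s.1) P a' u') :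
    a ≤ a' ↔ u.1 ≤ᵐ[volume] u'.1 := by
  have key : m (a \ a') = volume.real (u.1 \ u'.1) :=
    h.measure_sdiff_eq hm (isSigmaMeasure_measureReal volume) hP hPm h'
  rw [ae_le_set, ← measureReal_eq_zero_iff, ← key, ← sdiff_eq_bot_iff]
  exact ⟨fun h0 => by rw [h0, hm.bot], hpos _⟩

/-- An atomless, countably generated probability algebra is isomorphic to the measure algebra of
the unit interval. -/
theorem IsSigmaMeasure.exists_orderIso_unitInterval (hm : IsSigmaMeasure m)
    (hpos : ∀ a, m a = 0 → a = ⊥) (b : ℕ → B)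
    (hgen : ∀ T : Set B, IsSigmaClosed T → (∀ n, b n ∈ T) → T = Set.univ)
    (hatom : ∀ a : B, ¬ IsAtom a) :
    ∃ e : B ≃o MeasureAlgebra (volume : Measure unitInterval),
      ∀ a : B, (e a).measure = ENNReal.ofReal (m a) := by
  let v : {s : Set unitInterval // MeasurableSet s} → ℝ := fun s => volume.real s.1
  have hv : IsSigmaMeasure v := isSigmaMeasure_measureReal volume
  let point : B → unitInterval := fun a => ⟨m a, hm.nonneg a, hm.le_one a⟩
  let pair : B → B × {s : Set unitInterval // MeasurableSet s} :=
    fun a => (a, ⟨Set.Iic (point a), measurableSet_Iic⟩)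
  let C : Set (B × {s : Set unitInterval // MeasurableSet s}) :=
    {p | ∃ n j, p = pair (dyadicChain b n j)}
  have hpair : ∀ a, v (pair a).2 = m a := fun a => by
    simp [v, pair, point, measureReal_def, hm.nonneg a]
  have hpair_mono : ∀ a c, a ≤ c → pair a ≤ pair c := fun a c h =>
    ⟨h, Set.Iic_subset_Iic.2 (hm.mono h : m a ≤ m c)⟩
  have hC : ∀ p ∈ C, ∀ q ∈ C, p ⊓ q ∈ C := by
    rintro _ ⟨n, i, rfl⟩ _ ⟨k, j, rfl⟩
    rcases dyadicChain_total b n i k j with h | h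
    · exact ⟨n, i, inf_eq_left.2 (hpair_mono _ _ h)⟩
    · exact ⟨k, j, inf_eq_right.2 (hpair_mono _ _ h)⟩
  let P : Set (B × {s : Set unitInterval // MeasurableSet s}) := {p | FiniteDynkin C p}
  have hP : IsBooleanClosed P := FiniteDynkin.isBooleanClosed hC
  have hchainP : ∀ n j, pair (dyadicChain b n j) ∈ P := fun n j => .basic _ ⟨n, j, rfl⟩
  -- Normalized additive measures that agree on `C` agree on whatever complements and disjoint
  -- suprema reach. `P` is a Boolean algebra because `C` is a chain, hence closed under infima.
  have hPm : ∀ p ∈ P, m p.1 = v p.2 := fun p hp => by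
    induction hp with
    | basic p hp =>
      obtain ⟨n, j, rfl⟩ := hp
      exact (hpair _).symm
    | top => exact hm.top.trans hv.top.symm
    | compl p _ ih => exact (hm.compl p.1).trans ((hv.compl p.2).trans (by rw [ih])).symm
    | sup p q hpq _ _ ihp ihq =>
      rw [Prod.disjoint_iff] at hpq
      exact (hm.sup _ _ hpq.1).trans ((hv.sup _ _ hpq.2).trans (by rw [ihp, ihq])).symm
  have hPd : ∀ p ∈ P, ∀ q ∈ P, m (p.1 ∆ q.1) = v (p.2 ∆ q.2) := fun p hp q hq =>
    hPm _ (hP.sup_mem _ (hP.sdiff_mem hp hq) _ (hP.sdiff_mem hq hp))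
  have hchain_gen : ∀ T : Set B, IsSigmaClosed T → (∀ n j, dyadicChain b n j ∈ T) →
      T = Set.univ := fun T hT h => hgen T hT (mem_of_dyadicChain_mem b hT.isBooleanClosed h)
  have hfst : IsBooleanClosed (Prod.fst '' P) := by
    refine ⟨⟨_, hP.bot_mem, rfl⟩, ?_, ?_⟩
    · rintro _ ⟨p, hp, rfl⟩
      exact ⟨_, hP.compl_mem p hp, rfl⟩
    · rintro _ ⟨p, hp, rfl⟩ _ ⟨q, hq, rfl⟩
      exact ⟨_, hP.sup_mem p hp q hq, rfl⟩
  have hsnd : IsBooleanClosed (Prod.snd '' P) := by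
    refine ⟨⟨_, hP.bot_mem, rfl⟩, ?_, ?_⟩
    · rintro _ ⟨p, hp, rfl⟩
      exact ⟨_, hP.compl_mem p hp, rfl⟩
    · rintro _ ⟨p, hp, rfl⟩ _ ⟨q, hq, rfl⟩
      exact ⟨_, hP.sup_mem p hp q hq, rfl⟩
  have hleft : ∀ a, ∃ u, LimitRelation m v P a u := fun a => by
    refine exists_limitRelation hm hv hPd fun ε hε => ?_
    have h1 := hchain_gen _ (hm.approximable_isSigmaClosed hfst) fun n j ε hε =>
      ⟨_, ⟨_, hchainP n j, rfl⟩, by simpa [pair, hm.bot] using hε⟩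
    obtain ⟨_, ⟨p, hp, rfl⟩, h⟩ := (h1 ▸ Set.mem_univ a : a ∈ approximable m _) ε hε
    exact ⟨p, hp, h⟩
  have hdense : ∀ p q : ℝ, 0 ≤ p → p < q → q ≤ 1 → ∃ x : unitInterval, p < x ∧ (x : ℝ) < q ∧
      ⟨Set.Iic x, measurableSet_Iic⟩ ∈ Prod.snd '' P := fun p q h0 hpq h1 => by
    -- The doubly indexed chain is enumerated by `Nat.unpair`; level `0` supplies `⊥` and `⊤` at
    -- thresholds `0` and `1`.
    obtain ⟨i, hi⟩ := hm.exists_chain_measure_between hatom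
      (k := fun i => dyadicChain b i.unpair.1 i.unpair.2) (fun i j => dyadicChain_total b _ _ _ _)
      ⟨Nat.pair 0 0, by simp [dyadicChain]⟩ ⟨Nat.pair 0 1, by simp [dyadicChain]⟩
      (fun T hT h => hchain_gen T hT fun n j => by simpa using h (Nat.pair n j)) h0 hpq h1
    exact ⟨point (dyadicChain b i.unpair.1 i.unpair.2), hi.1, hi.2, _, hchainP _ _, rfl⟩
  have hbotP : ⟨Set.Iic 0, measurableSet_Iic⟩ ∈ Prod.snd '' P := by
    refine ⟨_, hchainP 0 0, ?_⟩
    simp only [pair, point, dyadicChain, if_true, hm.bot]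
    rfl
  have hright : ∀ u, ∃ a, LimitRelation m v P a u := fun u => by
    have h1 := (hv.approximable_isSigmaClosed hsnd).mem_of_generateFrom
      ((BorelSpace.measurable_eq).trans (borel_eq_generateFrom_Iic unitInterval))
      (fun s hs hsI => by
        obtain ⟨x, rfl⟩ := hsI
        exact approximable_Iic_of_dense hbotP hdense x) u
    obtain ⟨a, ha⟩ := exists_limitRelation (P := Prod.swap ⁻¹' P) hv hm
      (fun p hp q hq => (hPd _ hp _ hq).symm) (a := u) fun ε hε => by
        obtain ⟨_, ⟨p, hp, rfl⟩, h⟩ := h1 ε hε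
        exact ⟨p.swap, hp, h⟩
    exact ⟨a, ha.swap⟩
  obtain ⟨e, he⟩ := exists_orderIso_of_relation
    (fun a (q : MeasureAlgebra (volume : Measure unitInterval)) =>
      ∃ u, Quotient.mk (measureAlgebraSetoid volume) u = q ∧ LimitRelation m v P a u)
    (fun a => (hleft a).elim fun u hu => ⟨_, u, rfl, hu⟩)
    (fun q => by
      induction q using Quotient.inductionOn with
      | h u => exact (hright u).elim fun a ha => ⟨a, u, rfl, ha⟩)
    (by
      rintro a _ a' _ ⟨u, rfl, hu⟩ ⟨u', rfl, hu'⟩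
      exact hu.measureAlgebra_le_iff hm hpos hP hPm hu')
  refine ⟨e, fun a => ?_⟩
  obtain ⟨u, hu, hau⟩ := he a
  have hbot : LimitRelation m v P ⊥ ⊥ := fun ε hε =>
    ⟨⊥, hP.bot_mem, by simpa [hm.bot] using hε, by simpa [hv.bot] using hε⟩
  have h1 := hau.measure_sdiff_eq hm hv hP hPm hbot
  rw [sdiff_bot, sdiff_bot] at h1
  rw [← hu, h1]
  exact (ofReal_measureReal (μ := volume) (s := u.1)).symm

end UnitInterval

end MeasureIsomorphism

/-! ### Natural density, upper-density limits and almost unions -/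

section NaturalDensity

open scoped symmDiff

theorem countRatio_mono {A B : Set ℕ} (h : A ⊆ B) (n : ℕ) : countRatio A n ≤ countRatio B n := by
  unfold countRatio
  gcongr
  exact finite_window B n

theorem countRatio_union {A B : Set ℕ} (h : Disjoint A B) (n : ℕ) :
    countRatio (A ∪ B) n = countRatio A n + countRatio B n := by
  unfold countRatio
  rw [← add_div, Set.union_inter_distrib_right, Set.ncard_union_eq
    (h.mono Set.inter_subset_left Set.inter_subset_left) (finite_window A n) (finite_window B n),
    Nat.cast_add]

theorem countRatio_sdiff {A B : Set ℕ} (h : A ⊆ B) (n : ℕ) :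
    countRatio (B \ A) n = countRatio B n - countRatio A n := by
  have := countRatio_union (disjoint_sdiff_self_right : Disjoint A (B \ A)) n
  rw [Set.union_sdiff_cancel h] at this
  linarith

theorem abs_countRatio_sub_le (A B : Set ℕ) (n : ℕ) :
    |countRatio A n - countRatio B n| ≤ countRatio (A ∆ B) n := by
  have h1 := countRatio_le_add (le_symmDiff_sup_right A B) n
  have h2 := countRatio_le_add (le_symmDiff_sup_left A B) n
  rw [abs_le]
  constructor <;> linarith

theorem hasDensity_univ : HasDensity Set.univ 1 := by
  refine tendsto_const_nhds.congr' ?_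
  filter_upwards [eventually_ge_atTop 1] with n hn
  have : (n : ℝ) ≠ 0 := by exact_mod_cast (by omega : n ≠ 0)
  simp [countRatio, Set.ncard_eq_toFinset_card', this]

theorem HasDensity.union {A B : Set ℕ} {r s : ℝ} (hA : HasDensity A r) (hB : HasDensity B s)
    (h : Disjoint A B) : HasDensity (A ∪ B) (r + s) :=
  (Tendsto.add hA hB).congr fun n => (countRatio_union h n).symm

theorem HasDensity.sdiff {A B : Set ℕ} {r s : ℝ} (hA : HasDensity A r) (hB : HasDensity B s)
    (h : A ⊆ B) : HasDensity (B \ A) (s - r) :=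
  (Tendsto.sub hB hA).congr fun n => (countRatio_sdiff h n).symm

theorem HasDensity.compl {A : Set ℕ} {r : ℝ} (hA : HasDensity A r) : HasDensity Aᶜ (1 - r) := by
  rw [Set.compl_eq_univ_sdiff]
  exact hA.sdiff hasDensity_univ (Set.subset_univ A)

theorem IsDensitySet.hasDensity {A : Set ℕ} (h : IsDensitySet A) :
    HasDensity A (naturalDensity A) := by
  obtain ⟨r, hr⟩ := h
  rwa [hr.naturalDensity_eq]

theorem Set.Finite.isNullSet {A : Set ℕ} (hA : A.Finite) : IsNullSet A := by
  refine squeeze_zero (countRatio_nonneg A) (fun n => ?_)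
    (tendsto_const_div_atTop_nhds_zero_nat (A.ncard : ℝ))
  unfold countRatio
  gcongr
  exact Set.inter_subset_left

theorem isNullSet_of_forall_eventually_le {A : Set ℕ}
    (h : ∀ ε > 0, ∀ᶠ n in atTop, countRatio A n ≤ ε) : IsNullSet A := by
  refine tendsto_order.2 ⟨fun a ha => Eventually.of_forall fun n =>
    ha.trans_le (countRatio_nonneg A n), fun a ha => ?_⟩
  filter_upwards [h (a / 2) (by linarith)] with n hn
  linarith

theorem IsNullSet.eventually_le {A : Set ℕ} (h : IsNullSet A) {ε : ℝ} (hε : 0 < ε) :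
    ∀ᶠ n in atTop, countRatio A n ≤ ε :=
  ((tendsto_order.1 h).2 ε hε).mono fun _ hn => hn.le

/-- Unlike general unions, complements and disjoint unions preserve the existence of the density.
This is why the generated algebra is described by `FiniteDynkin`. -/
theorem FiniteDynkin.isDensitySet {F : Set (Set ℕ)} (hF : ∀ A ∈ F, IsDensitySet A) {A : Set ℕ}
    (hA : FiniteDynkin F A) : IsDensitySet A := by
  induction hA with
  | basic A hA => exact hF A hA
  | top => exact ⟨1, hasDensity_univ⟩
  | compl A _ ih => exact ih.elim fun r hr => ⟨_, hr.compl⟩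
  | sup A B h _ _ ihA ihB =>
    obtain ⟨r, hr⟩ := ihA
    obtain ⟨s, hs⟩ := ihB
    exact ⟨_, hr.union hs h⟩

/-- `A` is approximated, up to small upper density, by members of `E`. -/
def IsDensityLimit (E : Set (Set ℕ)) (A : Set ℕ) : Prop :=
  ∀ ε > 0, ∃ B ∈ E, ∀ᶠ n in atTop, countRatio (A ∆ B) n ≤ ε

theorem isDensityLimit_of_mem {E : Set (Set ℕ)} {A : Set ℕ} (hA : A ∈ E) : IsDensityLimit E A :=
  fun ε hε => ⟨A, hA, Eventually.of_forall fun n => by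
    rw [symmDiff_self]
    simpa [countRatio] using hε.le⟩

/-- The ratios of `A` are eventually uniformly close to convergent ones, hence Cauchy: comparing
indices `n` and `N` through `B` and its density costs four errors of `ε / 8`. -/
theorem IsDensityLimit.isDensitySet {E : Set (Set ℕ)} (hE : ∀ A ∈ E, IsDensitySet A) {A : Set ℕ}
    (hA : IsDensityLimit E A) : IsDensitySet A := by
  refine cauchySeq_tendsto_of_complete (Metric.cauchySeq_iff'.2 fun ε hε => ?_)
  obtain ⟨B, hB, h⟩ := hA (ε / 8) (by linarith)
  have hBr := (hE B hB).hasDensity.eventually (Metric.ball_mem_nhds _ (by linarith : 0 < ε / 8))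
  obtain ⟨N, hN⟩ := eventually_atTop.1 (h.and hBr)
  refine ⟨N, fun n hn => ?_⟩
  obtain ⟨h1, h2⟩ := hN n hn
  obtain ⟨h3, h4⟩ := hN N le_rfl
  have i1 := (abs_countRatio_sub_le A B n).trans h1
  have i2 := (abs_countRatio_sub_le A B N).trans h3
  rw [Real.dist_eq] at h2 h4
  rw [Real.dist_eq]
  rw [abs_le] at i1 i2
  rw [abs_lt] at h2 h4 ⊢
  constructor <;> linarith [i1.1, i1.2, i2.1, i2.2, h2.1, h2.2, h4.1, h4.2]

theorem IsDensityLimit.trans {E : Set (Set ℕ)} {A : Set ℕ}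
    (hA : IsDensityLimit {B | IsDensityLimit E B} A) : IsDensityLimit E A := fun ε hε => by
  obtain ⟨B, hB, h1⟩ := hA (ε / 2) (by linarith)
  obtain ⟨C, hC, h2⟩ := hB (ε / 2) (by linarith)
  refine ⟨C, hC, ?_⟩
  filter_upwards [h1, h2] with n hn1 hn2
  linarith [countRatio_le_add (symmDiff_triangle A B C) n]

theorem isBooleanClosed_isDensityLimit {E : Set (Set ℕ)} (hE : IsBooleanClosed E) :
    IsBooleanClosed {A | IsDensityLimit E A} where
  bot_mem := isDensityLimit_of_mem hE.bot_mem
  compl_mem A hA ε hε := by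
    obtain ⟨B, hB, h⟩ := hA ε hε
    exact ⟨Bᶜ, hE.compl_mem B hB, by rwa [compl_symmDiff_compl]⟩
  sup_mem A hA B hB ε hε := by
    obtain ⟨C, hC, h1⟩ := hA (ε / 2) (by linarith)
    obtain ⟨D, hD, h2⟩ := hB (ε / 2) (by linarith)
    refine ⟨C ⊔ D, hE.sup_mem C hC D hD, ?_⟩
    filter_upwards [h1, h2] with n hn1 hn2
    linarith [countRatio_le_add (sup_symmDiff_sup_le A B C D) n]

/-- Diagonalization: if each `p k` holds eventually, then `p (κ n) n` holds eventually for some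
monotone `κ` tending to infinity. -/
theorem exists_monotone_tendsto_eventually {p : ℕ → ℕ → Prop} (hp : ∀ k, ∀ᶠ n in atTop, p k n) :
    ∃ κ : ℕ → ℕ, Monotone κ ∧ Tendsto κ atTop atTop ∧ ∀ᶠ n in atTop, p (κ n) n := by
  classical
  -- Requiring `p k` from `n` onwards makes the condition monotone in `n`, so the largest admissible
  -- `k ≤ n` is monotone too.
  let q : ℕ → ℕ → Prop := fun n k => ∀ i ≥ n, p k i
  have hq : ∀ k, ∃ N, ∀ n ≥ N, q n k := fun k => by
    obtain ⟨N, hN⟩ := eventually_atTop.1 (hp k)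
    exact ⟨N, fun n hn i hi => hN i (hn.trans hi)⟩
  refine ⟨fun n => Nat.findGreatest (q n) n, fun i j hij => ?_, ?_, ?_⟩
  · exact Nat.findGreatest_mono (fun k hk l hl => hk l (hij.trans hl)) hij
  · refine tendsto_atTop.2 fun k => ?_
    obtain ⟨N, hN⟩ := hq k
    filter_upwards [eventually_ge_atTop (max k N)] with n hn
    exact Nat.le_findGreatest ((le_max_left _ _).trans hn) (hN n ((le_max_right _ _).trans hn))
  -- `Nat.findGreatest` defaults to `0`, so its specification needs one admissible value; `k = 0` is
  -- admissible for large `n`.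
  · obtain ⟨N, hN⟩ := hq 0
    filter_upwards [eventually_ge_atTop N] with n hn
    exact Nat.findGreatest_spec (P := q n) (Nat.zero_le n) (hN n hn) n le_rfl

/-- A monotone sequence of density sets has an upper bound modulo finite sets that exceeds the
members of the sequence by arbitrarily small upper density. -/
theorem exists_almost_union {A : ℕ → Set ℕ} (hA : Monotone A) (hd : ∀ n, IsDensitySet (A n)) :
    ∃ C : Set ℕ, (∀ n, IsNullSet (A n \ C)) ∧
      ∀ ε > 0, ∃ n, ∀ᶠ N in atTop, countRatio (C \ A n) N ≤ ε := by
  set d : ℕ → ℝ := fun n => naturalDensity (A n)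
  have hdlim : ∀ n, Tendsto (countRatio (A n)) atTop (𝓝 (d n)) := fun n => (hd n).hasDensity
  have hdmono : Monotone d := fun i j hij =>
    le_of_tendsto_of_tendsto' (hdlim i) (hdlim j) (countRatio_mono (hA hij))
  have hd1 : ∀ n, d n ≤ 1 := fun n =>
    le_of_tendsto_of_tendsto' (hdlim n) hasDensity_univ (countRatio_mono (Set.subset_univ _))
  obtain ⟨κ, hκ, hκlim, hκp⟩ := exists_monotone_tendsto_eventually
    (p := fun k N => countRatio (A k) N < d k + 1 / ((k : ℝ) + 1))
    (fun k => (hdlim k).eventually (gt_mem_nhds (by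
      have : (0 : ℝ) < 1 / ((k : ℝ) + 1) := by positivity
      linarith)))
  refine ⟨{x | x ∈ A (κ x)}, fun n => Set.Finite.isNullSet ?_, fun ε hε => ?_⟩
  · obtain ⟨N, hN⟩ := eventually_atTop.1 (hκlim.eventually_ge_atTop n)
    refine (Set.finite_lt_nat N).subset fun x hx => ?_
    by_contra h
    exact hx.2 (hA (hN x (not_lt.1 h)) hx.1)
  · have hdsup := tendsto_atTop_ciSup hdmono ⟨1, by rintro _ ⟨n, rfl⟩; exact hd1 n⟩
    obtain ⟨n, hn⟩ := (hdsup.eventually (lt_mem_nhds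
      (show (⨆ i, d i) - ε / 3 < ⨆ i, d i by linarith))).exists
    have hinv := (tendsto_one_div_add_atTop_nhds_zero_nat (𝕜 := ℝ)).comp hκlim
    refine ⟨n, ?_⟩
    filter_upwards [hκp, hκlim.eventually_ge_atTop n,
      hinv.eventually (gt_mem_nhds (show 0 < ε / 3 by linarith)),
      (hdlim n).eventually (lt_mem_nhds (show d n - ε / 3 < d n by linarith))]
      with N h1 h2 h3 h4
    -- Up to `N`, monotonicity of `κ` places the diagonal set inside `A (κ N)`, whose ratio at `N`
    -- was controlled by the choice of `κ`. The three errors of `ε / 3` are `1 / (κ N + 1)`, the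
    -- distance from `d n` to the supremum, and the deviation of the ratio of `A n` from `d n`.
    have h5 : countRatio ({x | x ∈ A (κ x)} \ A n) N ≤ countRatio (A (κ N) \ A n) N := by
      unfold countRatio
      gcongr ?_ / _
      refine Nat.cast_le.2 (Set.ncard_le_ncard ?_ (finite_window _ N))
      rintro x ⟨⟨hx, hxn⟩, hxN⟩
      exact ⟨⟨hA (hκ hxN.2) hx, hxn⟩, hxN⟩
    rw [countRatio_sdiff (hA h2)] at h5
    have h6 : d (κ N) ≤ ⨆ i, d i := le_ciSup ⟨1, by rintro _ ⟨n, rfl⟩; exact hd1 n⟩ (κ N)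
    simp only [Function.comp_apply] at h3
    linarith

end NaturalDensity

/-! ### The algebra of classes, its suprema and its generation -/

section DensityAlgebra

open scoped symmDiff

/-- An algebra of density sets that is closed under approximation in upper density. -/
structure DensityAlgebra where
  /-- The members of the algebra. -/
  carrier : Set (Set ℕ)
  isBooleanClosed : IsBooleanClosed carrier
  isDensitySet : ∀ A ∈ carrier, IsDensitySet A
  mem_of_limit : ∀ A, IsDensityLimit carrier A → A ∈ carrier

/-- The density algebra generated by a family of density sets closed under intersections. -/
def DensityAlgebra.generate (F : Set (Set ℕ)) (hF : ∀ A ∈ F, IsDensitySet A)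
    (hinter : ∀ A ∈ F, ∀ B ∈ F, A ∩ B ∈ F) : DensityAlgebra where
  carrier := {A | IsDensityLimit {B | FiniteDynkin F B} A}
  isBooleanClosed := isBooleanClosed_isDensityLimit (FiniteDynkin.isBooleanClosed hinter)
  isDensitySet _ hA := IsDensityLimit.isDensitySet (fun _ hB => FiniteDynkin.isDensitySet hF hB) hA
  mem_of_limit _ hA := IsDensityLimit.trans hA

theorem DensityClass.mk_le_mk {A B : DensitySet} :
    DensityClass.mk A ≤ DensityClass.mk B ↔ IsNullSet (A.1 \ B.1) := by
  refine Iff.trans (b := ∃ N : Set ℕ, IsNullSet N ∧ A.1 ⊆ B.1 ∪ N) Iff.rfl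
    ⟨fun ⟨N, hN, h⟩ => hN.mono (Set.sdiff_subset_iff.2 h), fun h => ⟨_, h, ?_⟩⟩
  rw [Set.union_sdiff_self]
  exact Set.subset_union_right

namespace DensityAlgebra

variable {E : DensityAlgebra}

/-- The classes of the members of `E`. -/
def Classes (E : DensityAlgebra) : Type := {c : DensityClass // ∃ A ∈ E.carrier, c.IsClassOf A}

instance : PartialOrder E.Classes := inferInstanceAs (PartialOrder (Subtype _))

/-- The inclusion of the classes of members of `E` in all density classes. -/
def inclusion : E.Classes ↪o DensityClass := OrderEmbedding.subtype _


theorem compl_mem {A : Set ℕ} (hA : A ∈ E.carrier) : Aᶜ ∈ E.carrier :=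
  E.isBooleanClosed.compl_mem A hA

theorem union_mem {A B : Set ℕ} (hA : A ∈ E.carrier) (hB : B ∈ E.carrier) : A ∪ B ∈ E.carrier :=
  E.isBooleanClosed.sup_mem A hA B hB

theorem inter_mem {A B : Set ℕ} (hA : A ∈ E.carrier) (hB : B ∈ E.carrier) : A ∩ B ∈ E.carrier :=
  E.isBooleanClosed.inf_mem hA hB

theorem empty_mem : ∅ ∈ E.carrier := E.isBooleanClosed.bot_mem

theorem univ_mem : Set.univ ∈ E.carrier := by simpa using compl_mem E.empty_mem

theorem mem_of_isNullSet {A B : Set ℕ} (hA : A ∈ E.carrier) (h : IsNullSet (B ∆ A)) :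
    B ∈ E.carrier :=
  E.mem_of_limit B fun _ hε => ⟨A, hA, h.eventually_le hε⟩

/-- The class of a member of `E`. -/
def cls (A : Set ℕ) (hA : A ∈ E.carrier) : E.Classes :=
  ⟨DensityClass.mk ⟨A, E.isDensitySet A hA⟩, A, hA, E.isDensitySet A hA, rfl⟩

theorem exists_cls (a : E.Classes) : ∃ A, ∃ hA : A ∈ E.carrier, cls A hA = a := by
  obtain ⟨c, A, hA, h, rfl⟩ := a
  exact ⟨A, hA, rfl⟩

theorem cls_le_cls {A B : Set ℕ} {hA : A ∈ E.carrier} {hB : B ∈ E.carrier} :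
    cls A hA ≤ cls B hB ↔ IsNullSet (A \ B) :=
  DensityClass.mk_le_mk

theorem inclusion_cls_le_mk {A : Set ℕ} {hA : A ∈ E.carrier} {D : DensitySet} :
    inclusion (cls A hA) ≤ DensityClass.mk D ↔ IsNullSet (A \ D.1) :=
  DensityClass.mk_le_mk

theorem cls_eq_cls {A B : Set ℕ} {hA : A ∈ E.carrier} {hB : B ∈ E.carrier} :
    cls A hA = cls B hB ↔ IsNullSet (A ∆ B) := by
  rw [le_antisymm_iff, cls_le_cls, cls_le_cls]
  exact ⟨fun h => h.1.of_subset_union h.2 subset_rfl, fun h =>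
    ⟨h.mono Set.subset_union_left, h.mono Set.subset_union_right⟩⟩

/-- The carrier is closed under null changes, so every representative of a class in the algebra lies
in the carrier, and set operations may be applied to any representative. -/
theorem isClassOf_iff {a : E.Classes} {A : Set ℕ} :
    (inclusion a).IsClassOf A ↔ ∃ hA : A ∈ E.carrier, cls A hA = a := by
  constructor
  · rintro ⟨hA, h⟩
    obtain ⟨B, hB, rfl⟩ := exists_cls a
    have hBA : IsNullSet (B ∆ A) := Quotient.exact h
    have hAE : A ∈ E.carrier := mem_of_isNullSet hB (by rwa [symmDiff_comm])
    exact ⟨hAE, Subtype.ext h.symm⟩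
  · rintro ⟨hA, rfl⟩
    exact ⟨E.isDensitySet A hA, rfl⟩

/-- A representative of a class. -/
noncomputable def rep (a : E.Classes) : Set ℕ := (exists_cls a).choose

theorem rep_mem (a : E.Classes) : rep a ∈ E.carrier := (exists_cls a).choose_spec.choose

theorem cls_rep (a : E.Classes) : cls (rep a) (rep_mem a) = a :=
  (exists_cls a).choose_spec.choose_spec

theorem isNullSet_rep_cls {A : Set ℕ} (hA : A ∈ E.carrier) : IsNullSet (rep (cls A hA) ∆ A) :=
  cls_eq_cls.1 (cls_rep (cls A hA))

noncomputable instance : Max E.Classes :=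
  ⟨fun a b => cls (rep a ∪ rep b) (union_mem (rep_mem a) (rep_mem b))⟩

noncomputable instance : Min E.Classes :=
  ⟨fun a b => cls (rep a ∩ rep b) (inter_mem (rep_mem a) (rep_mem b))⟩

noncomputable instance : Compl E.Classes := ⟨fun a => cls (rep a)ᶜ (compl_mem (rep_mem a))⟩

instance : Top E.Classes := ⟨cls Set.univ univ_mem⟩

instance : Bot E.Classes := ⟨cls ∅ empty_mem⟩

theorem top_def : (⊤ : E.Classes) = cls Set.univ univ_mem := rfl

theorem bot_def : (⊥ : E.Classes) = cls ∅ empty_mem := rfl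

theorem cls_compl {A : Set ℕ} (hA : A ∈ E.carrier) :
    (cls A hA)ᶜ = cls Aᶜ (compl_mem hA) := by
  refine cls_eq_cls.2 ?_
  rw [compl_symmDiff_compl]
  exact isNullSet_rep_cls hA

theorem cls_sup_cls {A B : Set ℕ} (hA : A ∈ E.carrier) (hB : B ∈ E.carrier) :
    cls A hA ⊔ cls B hB = cls (A ∪ B) (union_mem hA hB) :=
  cls_eq_cls.2 ((isNullSet_rep_cls hA).of_subset_union (isNullSet_rep_cls hB)
    (sup_symmDiff_sup_le _ _ _ _))

theorem cls_inf_cls {A B : Set ℕ} (hA : A ∈ E.carrier) (hB : B ∈ E.carrier) :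
    cls A hA ⊓ cls B hB = cls (A ∩ B) (inter_mem hA hB) := by
  refine cls_eq_cls.2 ((isNullSet_rep_cls hA).of_subset_union (isNullSet_rep_cls hB) ?_)
  exact inf_symmDiff_inf_le _ _ _ _

theorem cls_le_cls_of_subset {A B : Set ℕ} {hA : A ∈ E.carrier} {hB : B ∈ E.carrier}
    (h : A ⊆ B) : cls A hA ≤ cls B hB := by
  rw [cls_le_cls, Set.sdiff_eq_empty.2 h]
  exact isNullSet_empty

noncomputable instance : BooleanAlgebra E.Classes where
  sup a b := a ⊔ b
  inf a b := a ⊓ b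
  le_sup_left a b := by
    obtain ⟨A, hA, rfl⟩ := exists_cls a
    obtain ⟨B, hB, rfl⟩ := exists_cls b
    rw [cls_sup_cls]
    exact cls_le_cls_of_subset Set.subset_union_left
  le_sup_right a b := by
    obtain ⟨A, hA, rfl⟩ := exists_cls a
    obtain ⟨B, hB, rfl⟩ := exists_cls b
    rw [cls_sup_cls]
    exact cls_le_cls_of_subset Set.subset_union_right
  sup_le a b c hac hbc := by
    obtain ⟨A, hA, rfl⟩ := exists_cls a
    obtain ⟨B, hB, rfl⟩ := exists_cls b
    obtain ⟨C, hC, rfl⟩ := exists_cls c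
    rw [cls_le_cls] at hac hbc
    rw [cls_sup_cls, cls_le_cls, Set.union_sdiff_distrib]
    exact hac.of_subset_union hbc subset_rfl
  inf_le_left a b := by
    obtain ⟨A, hA, rfl⟩ := exists_cls a
    obtain ⟨B, hB, rfl⟩ := exists_cls b
    rw [cls_inf_cls]
    exact cls_le_cls_of_subset Set.inter_subset_left
  inf_le_right a b := by
    obtain ⟨A, hA, rfl⟩ := exists_cls a
    obtain ⟨B, hB, rfl⟩ := exists_cls b
    rw [cls_inf_cls]
    exact cls_le_cls_of_subset Set.inter_subset_right
  le_inf a b c hab hac := by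
    obtain ⟨A, hA, rfl⟩ := exists_cls a
    obtain ⟨B, hB, rfl⟩ := exists_cls b
    obtain ⟨C, hC, rfl⟩ := exists_cls c
    rw [cls_le_cls] at hab hac
    rw [cls_inf_cls, cls_le_cls, Set.sdiff_inter]
    exact hab.of_subset_union hac subset_rfl
  le_sup_inf a b c := by
    obtain ⟨A, hA, rfl⟩ := exists_cls a
    obtain ⟨B, hB, rfl⟩ := exists_cls b
    obtain ⟨C, hC, rfl⟩ := exists_cls c
    simp only [cls_sup_cls, cls_inf_cls]
    exact cls_le_cls_of_subset (Set.union_inter_distrib_left A B C).superset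
  inf_compl_le_bot a := by
    obtain ⟨A, hA, rfl⟩ := exists_cls a
    rw [cls_compl, cls_inf_cls, bot_def]
    exact cls_le_cls_of_subset (Set.inter_compl_self A).subset
  top_le_sup_compl a := by
    obtain ⟨A, hA, rfl⟩ := exists_cls a
    rw [cls_compl, cls_sup_cls, top_def]
    exact cls_le_cls_of_subset (Set.union_compl_self A).superset
  le_top a := by
    obtain ⟨A, hA, rfl⟩ := exists_cls a
    exact cls_le_cls_of_subset (Set.subset_univ A)
  bot_le a := by
    obtain ⟨A, hA, rfl⟩ := exists_cls a
    exact cls_le_cls_of_subset (Set.empty_subset A)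

theorem cls_symmDiff_cls {A B : Set ℕ} (hA : A ∈ E.carrier) (hB : B ∈ E.carrier) :
    cls A hA ∆ cls B hB = cls (A ∆ B) (union_mem (inter_mem hA (compl_mem hB))
      (inter_mem hB (compl_mem hA))) := by
  refine (symmDiff_eq _ _).trans ?_
  rw [cls_compl, cls_compl, cls_inf_cls, cls_inf_cls, cls_sup_cls]
  rfl

theorem partialSups_cls {A : ℕ → Set ℕ} (hA : ∀ n, A n ∈ E.carrier) (n : ℕ) :
    partialSups (fun n => cls (A n) (hA n)) n =
      cls (partialSups A n) (E.isBooleanClosed.partialSups_mem hA n) := by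
  induction n with
  | zero => simp
  | succ n ih =>
    rw [partialSups_add_one, ih, cls_sup_cls]
    simp only [partialSups_add_one]
    rfl

theorem hasDensity_cls {A : Set ℕ} (hA : A ∈ E.carrier) :
    HasDensity A (inclusion (cls A hA)).density :=
  (E.isDensitySet A hA).hasDensity

theorem density_le_of_eventually {A B : Set ℕ} (hA : A ∈ E.carrier) (hB : B ∈ E.carrier) {ε : ℝ}
    (h : ∀ᶠ n in atTop, countRatio A n ≤ countRatio B n + ε) :
    (inclusion (cls A hA)).density ≤ (inclusion (cls B hB)).density + ε :=
  le_of_tendsto_of_tendsto (hasDensity_cls hA) (Tendsto.add_const ε (hasDensity_cls hB)) h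

/-- Every sequence has a supremum in the classes, which is also its supremum among all density
classes and is approximated in density by the partial suprema. -/
theorem exists_isLUB_density (a : ℕ → E.Classes) : ∃ s : E.Classes, (∀ n, a n ≤ s) ∧
    (∀ c : DensityClass, (∀ n, inclusion (a n) ≤ c) → inclusion s ≤ c) ∧
    ∀ ε > 0, ∃ n, (inclusion s).density ≤ (inclusion (partialSups a n)).density + ε := by
  choose A hA ha using fun n => exists_cls (a n)
  obtain rfl : (fun n => cls (A n) (hA n)) = a := funext ha
  have hU := E.isBooleanClosed.partialSups_mem hA
  obtain ⟨C, hC, hCε⟩ := exists_almost_union (partialSups A).monotone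
    fun n => E.isDensitySet _ (hU n)
  have hCE : C ∈ E.carrier := by
    refine E.mem_of_limit C fun ε hε => ?_
    obtain ⟨n, hn⟩ := hCε (ε / 2) (by linarith)
    refine ⟨_, hU n, ?_⟩
    filter_upwards [hn, (hC n).eventually_le (show 0 < ε / 2 by linarith)] with N h1 h2
    have := countRatio_le_add (subset_rfl : C ∆ (partialSups A n) ⊆ _) N
    linarith
  refine ⟨cls C hCE, fun n => ?_, fun c hc => ?_, fun ε hε => ?_⟩
  · exact cls_le_cls.2 ((hC n).mono (Set.sdiff_subset_sdiff_left (le_partialSups A n)))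
  · obtain ⟨D, rfl⟩ : ∃ D, DensityClass.mk D = c := Quotient.exists_rep c
    have hAD : ∀ n, IsNullSet (A n \ D.1) := fun n => inclusion_cls_le_mk.1 (hc n)
    refine inclusion_cls_le_mk.2 ?_
    have hnull : ∀ n, IsNullSet (partialSups A n \ D.1) := fun n => by
      induction n with
      | zero => simpa using hAD 0
      | succ n ih =>
        rw [partialSups_add_one]
        refine ih.of_subset_union (hAD (n + 1)) ?_
        exact (Set.union_sdiff_distrib).subset
    -- `C \ D` is covered by `C` minus a partial union, of small upper density, and that partial
    -- union minus `D`, which is null.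
    refine isNullSet_of_forall_eventually_le fun ε hε => ?_
    obtain ⟨n, hn⟩ := hCε (ε / 2) (by linarith)
    filter_upwards [hn, (hnull n).eventually_le (show 0 < ε / 2 by linarith)] with N h1 h2
    have h3 : C \ D.1 ⊆ C \ partialSups A n ∪ partialSups A n \ D.1 := sdiff_triangle C _ _
    linarith [countRatio_le_add h3 N]
  · obtain ⟨n, hn⟩ := hCε ε hε
    refine ⟨n, ?_⟩
    rw [partialSups_cls]
    refine density_le_of_eventually _ _ ?_
    filter_upwards [hn] with N h1
    have h3 : C ⊆ partialSups A n ∪ C \ partialSups A n := by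
      rw [Set.union_sdiff_self]; exact Set.subset_union_right
    linarith [countRatio_le_add h3 N]

theorem isSigmaMeasure_density : IsSigmaMeasure fun a : E.Classes => (inclusion a).density := by
  have hmono : ∀ a b : E.Classes, a ≤ b →
      (inclusion a).density ≤ (inclusion b).density := fun a b hab => by
    obtain ⟨A, hA, rfl⟩ := exists_cls a
    obtain ⟨B, hB, rfl⟩ := exists_cls b
    have h := cls_le_cls.1 hab
    refine le_of_forall_pos_le_add fun ε hε => density_le_of_eventually _ _ ?_
    filter_upwards [h.eventually_le hε] with n hn
    have h3 : A ⊆ B ∪ A \ B := by rw [Set.union_sdiff_self]; exact Set.subset_union_right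
    linarith [countRatio_le_add h3 n]
  refine ⟨fun a => ?_, ?_, fun a b hab => ?_, fun a ha => ?_⟩
  · obtain ⟨A, hA, rfl⟩ := exists_cls a
    exact ge_of_tendsto' (hasDensity_cls hA) (countRatio_nonneg A)
  · exact tendsto_nhds_unique (hasDensity_cls univ_mem) hasDensity_univ
  · obtain ⟨A, hA, rfl⟩ := exists_cls a
    obtain ⟨B, hB, rfl⟩ := exists_cls b
    -- Disjoint classes have representatives that are disjoint only up to a null set; `B \ A`
    -- represents the class of `B` and is truly disjoint from `A`.
    have hBA : B \ A ∈ E.carrier := inter_mem hB (compl_mem hA)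
    have hnull : IsNullSet (B ∆ (B \ A)) := by
      rw [disjoint_iff, cls_inf_cls, bot_def, cls_eq_cls] at hab
      refine hab.mono fun x hx => Or.inl ?_
      rcases hx with ⟨h1, h2⟩ | ⟨h1, h2⟩
      · exact ⟨⟨by_contra fun h => h2 ⟨h1, h⟩, h1⟩, fun h => h⟩
      · exact absurd h1.1 h2
    rw [(cls_eq_cls (hB := hBA)).2 hnull, cls_sup_cls]
    exact tendsto_nhds_unique (hasDensity_cls (union_mem hA hBA))
      ((hasDensity_cls hA).union (hasDensity_cls hBA) disjoint_sdiff_self_right)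
  · obtain ⟨s, hs1, hs2, hs3⟩ := exists_isLUB_density a
    refine ⟨s, ⟨?_, fun c hc => hs2 (inclusion c) fun n => hc ⟨n, rfl⟩⟩, ?_⟩
    · rintro _ ⟨n, rfl⟩
      exact hs1 n
    · refine tendsto_order.2 ⟨fun r hr => ?_, fun r hr => Eventually.of_forall fun n =>
        (hmono _ _ (hs1 n)).trans_lt hr⟩
      obtain ⟨n, hn⟩ := hs3 (((inclusion s).density - r) / 2) (by linarith)
      rw [ha.partialSups_eq] at hn
      filter_upwards [eventually_ge_atTop n] with k hk
      linarith [hmono _ _ (ha hk)]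

theorem eq_bot_of_density_eq_zero (a : E.Classes) (h : (inclusion a).density = 0) : a = ⊥ := by
  obtain ⟨A, hA, rfl⟩ := exists_cls a
  have hnull : IsNullSet A := by
    have := hasDensity_cls hA
    rwa [h] at this
  rw [bot_def, cls_eq_cls]
  simpa [symmDiff_def] using hnull

theorem isSigmaAlgebraInclusion_inclusion : IsSigmaAlgebraInclusion (inclusion (E := E)) where
  map_bot := isClassOf_iff.2 ⟨empty_mem, rfl⟩
  map_top := isClassOf_iff.2 ⟨univ_mem, rfl⟩
  map_compl a A h := by
    obtain ⟨hA, rfl⟩ := isClassOf_iff.1 h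
    exact isClassOf_iff.2 ⟨_, (cls_compl hA).symm⟩
  map_inf a b A B h h' := by
    obtain ⟨hA, rfl⟩ := isClassOf_iff.1 h
    obtain ⟨hB, rfl⟩ := isClassOf_iff.1 h'
    exact isClassOf_iff.2 ⟨_, (cls_inf_cls hA hB).symm⟩
  map_sup a b A B h h' := by
    obtain ⟨hA, rfl⟩ := isClassOf_iff.1 h
    obtain ⟨hB, rfl⟩ := isClassOf_iff.1 h'
    exact isClassOf_iff.2 ⟨_, (cls_sup_cls hA hB).symm⟩
  exists_isLUB a := by
    obtain ⟨s, hs1, hs2, -⟩ := exists_isLUB_density a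
    refine ⟨s, ⟨?_, fun c hc => hs2 (inclusion c) fun n => hc ⟨n, rfl⟩⟩, ?_, fun c hc =>
      hs2 c fun n => hc ⟨n, rfl⟩⟩
    · rintro _ ⟨n, rfl⟩
      exact hs1 n
    · rintro _ ⟨n, rfl⟩
      exact hs1 n

section Generate

variable {F : Set (Set ℕ)} (hF : ∀ A ∈ F, IsDensitySet A) (hinter : ∀ A ∈ F, ∀ B ∈ F, A ∩ B ∈ F)

theorem mem_generate_of_finiteDynkin {A : Set ℕ} (hA : FiniteDynkin F A) :
    A ∈ (generate F hF hinter).carrier :=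
  isDensityLimit_of_mem hA

/-- The sets whose class lies in `T` form a Boolean algebra containing `F`, so their classes
approximate everything. `T` is metrically closed up to distance zero, and strict positivity of the
density turns distance zero into equality. -/
theorem eq_univ_of_isSigmaClosed {T : Set (generate F hF hinter).Classes} (hT : IsSigmaClosed T)
    (hFT : inclusion (E := generate F hF hinter) ⁻¹' classesOf F ⊆ T) : T = Set.univ := by
  have hm := isSigmaMeasure_density (E := generate F hF hinter)
  have hU : IsBooleanClosed {A | ∃ hA : A ∈ (generate F hF hinter).carrier, cls A hA ∈ T} := by
    refine ⟨⟨empty_mem, hT.bot_mem⟩, ?_, ?_⟩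
    · rintro A ⟨hA, h⟩
      exact ⟨compl_mem hA, cls_compl hA ▸ hT.compl_mem _ h⟩
    · rintro A ⟨hA, h⟩ B ⟨hB, h'⟩
      exact ⟨union_mem hA hB, cls_sup_cls hA hB ▸ hT.isBooleanClosed.sup_mem _ h _ h'⟩
  refine Set.eq_univ_of_forall fun a => ?_
  have ha : a ∈ approximable (fun a : (generate F hF hinter).Classes => (inclusion a).density) T := by
    intro ε hε
    obtain ⟨A, hA, rfl⟩ := exists_cls a
    obtain ⟨B, hB, h⟩ := (show IsDensityLimit {B | FiniteDynkin F B} A from hA) (ε / 2)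
      (by linarith)
    obtain ⟨hBE, hBT⟩ := FiniteDynkin.mem_of_isBooleanClosed hU (fun C hC =>
      have hCE := mem_generate_of_finiteDynkin hF hinter (.basic C hC)
      ⟨hCE, hFT ⟨C, hC, isClassOf_iff.2 ⟨hCE, rfl⟩⟩⟩) hB
    refine ⟨_, hBT, ?_⟩
    beta_reduce
    rw [cls_symmDiff_cls]
    exact (le_of_tendsto (hasDensity_cls _) h).trans_lt (by linarith)
  obtain ⟨v, hv, h⟩ := hm.exists_mem_symmDiff_eq_zero hT ha
  rwa [symmDiff_eq_bot.1 (eq_bot_of_density_eq_zero _ h)]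

end Generate

end DensityAlgebra

end DensityAlgebra

/-! ### The theorem -/

open DensityAlgebra in
theorem theorem1 (F : Set (Set ℕ)) (hF : ∀ A ∈ F, IsDensitySet A)
    (hinter : ∀ A ∈ F, ∀ B ∈ F, A ∩ B ∈ F) :
    ∃ (S : Type) (_ : BooleanAlgebra S) (ι : S ↪o DensityClass),
      IsSigmaAlgebraInclusion ι ∧
      classesOf F ⊆ Set.range ι ∧
      (∀ a : S, (ι a).density ∈ Set.Icc (0 : ℝ) 1) ∧
      IsSigmaAdditive ι ∧
      SigmaGenerates (ι ⁻¹' classesOf F) ∧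
      ((classesOf F).Countable → (∀ a : S, ¬ IsAtom a) →
        ∃ e : S ≃o MeasureAlgebra (volume : Measure unitInterval),
          ∀ a : S, (e a).measure = ENNReal.ofReal (ι a).density) := by
  have hm := isSigmaMeasure_density (E := generate F hF hinter)
  refine ⟨(generate F hF hinter).Classes, inferInstance, inclusion,
    isSigmaAlgebraInclusion_inclusion, ?_, fun a => ⟨hm.nonneg a, hm.le_one a⟩,
    fun a ha s hs => hm.hasSum_of_isLUB ha hs,
    fun T hFT hbot hcompl hlub => eq_univ_of_isSigmaClosed hF hinter ⟨hbot, hcompl, hlub⟩ hFT, ?_⟩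
  · rintro _ ⟨A, hA, hA', rfl⟩
    exact ⟨cls A (mem_generate_of_finiteDynkin hF hinter (.basic A hA)), rfl⟩
  · intro hcount hatom
    -- Adding `⊥` makes the generating set nonempty, so it is the range of a sequence even when `F`
    -- is empty.
    have hG := (hcount.preimage (inclusion (E := generate F hF hinter)).injective).insert ⊥
    obtain ⟨b, hb⟩ := hG.exists_eq_range ⟨⊥, Set.mem_insert _ _⟩
    exact hm.exists_orderIso_unitInterval eq_bot_of_density_eq_zero b
      (fun T hT h => eq_univ_of_isSigmaClosed hF hinter hT
        ((Set.subset_insert _ _).trans (hb ▸ Set.range_subset_iff.2 h))) hatom
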